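/- **Setting.** Let $\mathcal J$ be the space of Jacobi matrices, that is, of the bounded operators $(Ju)_n=a_nu_{n+1}+a_{n-1}u_{n-1}+b_nu_n$ on $\ell^2(\mathbb Z)$ with bounded real sequences $a_n>0$, $b_n$; give $\mathcal J$ the operator norm topology. Let $\mathbb Z$ act on $\mathcal J$ by shifts: $n\cdot J$ has the coefficients $(a_{k+n},b_{k+n})_k$. Fix a real-valued $f\in C^2(\mathbb R)$. For such a function $h$, let $h(J)_a$ be the infinite matrix with entries $\langle\delta_j,h(J)\delta_k\rangle$ for $j<k$, $-\langle\delta_j,h(J)\delta_k\rangle$ for $j>k$, and $0$ for $j=k$, and let $X_h(J)$ be the bounded operator whose matrix elements are those of $[h(J)_a,J]$ for $|j-k|\le 1$ and $0$ otherwise. Let $h\cdot J=J(1)$, where $J(t)$ is the global solution in $\mathcal J$ of the Lax equation $\dot J=X_h(J)$, $J(0)=J$ (derivative in operator norm), and write $t\cdot J:=(tf)\cdot J$ for $t\in\mathbb R$. The group $G=\mathbb R\times\mathbb Z$ acts on $\mathcal J$ by $(t,n)\cdot J=t\cdot(n\cdot J)$. Let $\mathbb{SL}$ be the group of entire functions $T:\mathbb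 C\to SL(2,\mathbb C)$ with $T(x)\in SL(2,\mathbb R)$ for $x\in\mathbb R$, and let $\mathfrak{sl}$ be the space of entire functions $B:\mathbb C\to\mathbb C^{2\times2}$ with $\operatorname{tr}B=0$ and $B(x)\in\mathbb R^{2\times2}$ for $x\in\mathbb R$, with the topology of locally uniform convergence. An $\mathbb{SL}$-cocycle for an action of a group $G$ on $X$ is a function $T:G\times X\to\mathbb{SL}$ with $T(gh;x)=T(g;h\cdot x)T(h;x)$ for all $g,h\in G$, $x\in X$. Let $$A(J)(z)=\begin{pmatrix}\frac{z-b_1}{a_1}&\frac1{a_1}\\-a_1&0\end{pmatrix},$$ and put $T(n;J)=A((n-1)\cdot J)\cdots A(J)$ for integers $n\ge0$ and $T(n;J)=T(-n;n\cdot J)^{-1}$ for $n<0$ (the shift cocycle). **Theorem.** Let $B:\mathcal J\to\mathfrak{sl}$ be continuous, and for $t\in\mathbb R$ let $T(t;J)$ be the solution of $\frac{d}{dt}T(t;J)=B(t\cdot J)T(t;J)$, $T(0;J)=1$. Then $$T((t,n);J):=T(t;n\cdot J)\,T(n;J),\qquad (t,n)\in\mathbb R\times\mathbb Z,$$ defines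 an $\mathbb{SL}$-cocycle for the action of $G=\mathbb R\times\mathbb Z$ on $\mathcal J$ if and only if the zero curvature equation $$\frac{d}{dt}A(t\cdot J)\Big|_{t=0}=B(1\cdot J)A(J)-A(J)B(J)$$ holds for every $J\in\mathcal J$; here $1\cdot J$ is the shift of $J$ by $1\in\mathbb Z$. -/

import Mathlib

open Filter Topology

noncomputable section

namespace Toda

/-- The complex Hilbert space `ℓ²(ℤ)`. -/
abbrev H : Type := lp (fun _ : ℤ => ℂ) 2

/-- The standard unit vector `δ_n`. -/
def delta (n : ℤ) : H := lp.single 2 n (1 : ℂ)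

/-- The matrix element `X_{jk} = ⟨δ_j, X δ_k⟩` of a bounded operator. -/
def entry (X : H →L[ℂ] H) (j k : ℤ) : ℂ := inner ℂ (delta j) (X (delta k))

/-- A bounded operator is a Jacobi matrix if
`(J u)_n = a_n u_{n+1} + a_{n-1} u_{n-1} + b_n u_n` for bounded real sequences `a`, `b` with
`a_n > 0`. -/
def IsJacobi (J : H →L[ℂ] H) : Prop :=
  ∃ a b : ℤ → ℝ, (∀ n, 0 < a n) ∧ (∃ C, ∀ n, |a n| ≤ C ∧ |b n| ≤ C) ∧
    ∀ (u : H) (n : ℤ),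
      J u n = (a n : ℂ) * u (n + 1) + (a (n - 1) : ℂ) * u (n - 1) + (b n : ℂ) * u n

/-- The space of Jacobi matrices; as a subtype of the bounded operators it carries the
operator norm topology. -/
abbrev Jac : Type := {J : H →L[ℂ] H // IsJacobi J}

/-- The off-diagonal coefficient `a_n = J_{n,n+1}`. -/
def coeffA (J : Jac) (n : ℤ) : ℝ := (entry J.1 n (n + 1)).re

/-- The diagonal coefficient `b_n = J_{n,n}`. -/
def coeffB (J : Jac) (n : ℤ) : ℝ := (entry J.1 n n).re

/-! ### The shift action of `ℤ` -/

theorem memlp_shift (n : ℤ) (u : H) : Memℓp (fun k : ℤ => (u (k + n) : ℂ)) 2 := by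
  have h := (memℓp_gen_iff (p := 2) (by norm_num)).1 (lp.memℓp u)
  refine (memℓp_gen_iff (p := 2) (by norm_num)).2 ?_
  exact (Equiv.addRight n).summable_iff.2 h

/-- The shift by `n` on `ℓ²(ℤ)`: `(S_n u)_k = u_{k+n}`. -/
def shiftOp (n : ℤ) : H →ₗᵢ[ℂ] H where
  toFun u := ⟨fun k => u (k + n), memlp_shift n u⟩
  map_add' _ _ := rfl
  map_smul' _ _ := rfl
  norm_map' u := by
    rw [lp.norm_eq_tsum_rpow (by norm_num), lp.norm_eq_tsum_rpow (by norm_num)]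
    congr 1
    exact (Equiv.addRight n).tsum_eq (fun k => ‖(u k : ℂ)‖ ^ (2 : ENNReal).toReal)

theorem isJacobi_shift (n : ℤ) (J : Jac) :
    IsJacobi ((shiftOp n).toContinuousLinearMap ∘L J.1 ∘L
      (shiftOp (-n)).toContinuousLinearMap) := by
  obtain ⟨a, b, ha, ⟨C, hC⟩, h⟩ := J.2
  refine ⟨fun k => a (k + n), fun k => b (k + n), fun k => ha _, ⟨C, fun k => hC _⟩, ?_⟩
  intro u k
  have h1 := h (shiftOp (-n) u) (k + n)
  have e : ∀ m : ℤ, (shiftOp (-n) u) m = u (m + -n) := fun _ => rfl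
  rw [e, e, e] at h1
  have e2 : k + n - 1 = k - 1 + n := by ring
  have e3 : k + n + 1 + -n = k + 1 := by ring
  have e4 : k - 1 + n + -n = k - 1 := by ring
  have e5 : k + n + -n = k := by ring
  rw [e2, e3, e4, e5] at h1
  exact h1

/-- The action `n · J` of `ℤ` by shifts: the coefficients of `n · J` are
`(a_{k+n}, b_{k+n})`. -/
def shift (n : ℤ) (J : Jac) : Jac :=
  ⟨(shiftOp n).toContinuousLinearMap ∘L J.1 ∘L (shiftOp (-n)).toContinuousLinearMap,
    isJacobi_shift n J⟩

/-! ### The Lax equation and the Toda flow -/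

/-- The continuous functional calculus `f(X)` of a bounded self-adjoint operator on a Hilbert
space. -/
def funCalc {E : Type*} [NormedAddCommGroup E] [InnerProductSpace ℂ E] [CompleteSpace E]
    (f : ℝ → ℝ) (X : E →L[ℂ] E) : E →L[ℂ] E := cfc f X

/-- The matrix of the anti-symmetric part `X_a`: `X_{jk}` above the diagonal, `-X_{jk}` below
it, and `0` on it. -/
def antiPart (X : H →L[ℂ] H) (j k : ℤ) : ℂ :=
  if j < k then entry X j k else if k < j then -entry X j k else 0

/-- The matrix elements of `X_f(J) = [f(J)_a, J]` for `|j - k| ≤ 1`, and `0` otherwise.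
Here `f(J)` is given by the continuous functional calculus, and the two products are products of
infinite matrices; as `J` is tridiagonal, the row times column sums are sums over
`l = k - 1, k, k + 1` and `l = j - 1, j, j + 1`. -/
def laxEntry (f : ℝ → ℝ) (J : Jac) (j k : ℤ) : ℂ :=
  if |j - k| ≤ 1 then
    (∑ l ∈ Finset.Icc (k - 1) (k + 1), antiPart (funCalc f J.1) j l * entry J.1 l k) -
      ∑ l ∈ Finset.Icc (j - 1) (j + 1), entry J.1 j l * antiPart (funCalc f J.1) l k
  else 0

/-- `φ : ℝ → 𝒥` is a global solution of the Lax equation `φ' = X_f(φ)`: at every time, the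
derivative in operator norm exists and is the bounded operator with the matrix elements of
`X_f(φ(t))`. -/
def IsLaxSolution (f : ℝ → ℝ) (φ : ℝ → Jac) : Prop :=
  ∀ t, ∃ D : H →L[ℂ] H, HasDerivAt (fun s => (φ s).1) D t ∧
    ∀ j k, entry D j k = laxEntry f (φ t) j k

open Classical in
/-- `f · J`: the value at time one of the global solution of `φ' = X_f(φ)`, `φ(0) = J`. (For
`f ∈ C²(ℝ)` there is exactly one such solution; the second branch is a dummy value.) -/
def todaMap (f : ℝ → ℝ) (J : Jac) : Jac :=
  if h : ∃ φ : ℝ → Jac, IsLaxSolution f φ ∧ φ 0 = J then h.choose 1 else J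

/-- The Toda flow `t · J = (t f) · J`. -/
def flow (f : ℝ → ℝ) (t : ℝ) (J : Jac) : Jac := todaMap (fun x => t * f x) J

/-- The action of `G = ℝ × ℤ` on Jacobi matrices, by the Toda flow of `f` and the shift. -/
def jointAct (f : ℝ → ℝ) (g : ℝ × ℤ) (J : Jac) : Jac := flow f g.1 (shift g.2 J)

/-! ### Matrix functions and cocycles -/

/-- Functions `ℂ → ℂ^{2×2}`. -/
abbrev MatFun : Type := ℂ → Matrix (Fin 2) (Fin 2) ℂ

/-- Entire matrix functions that are real on the real line. -/
def IsRealEntire (M : MatFun) : Prop :=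
  (∀ i j, Differentiable ℂ fun z => M z i j) ∧ ∀ (x : ℝ) (i j), (M (x : ℂ) i j).im = 0

/-- The group `𝕊𝕃` of entire functions `T : ℂ → SL(2, ℂ)` with `T(x) ∈ SL(2, ℝ)` for real `x`. -/
def SLset : Set MatFun := {T | IsRealEntire T ∧ ∀ z, (T z).det = 1}

/-- The space `𝔰𝔩` of entire traceless matrix functions that are real on the real line. -/
def slset : Set MatFun := {B | IsRealEntire B ∧ ∀ z, (B z).trace = 0}

/-- `T : G × X → 𝕊𝕃` is an `𝕊𝕃`-cocycle for the action `act` of the additively written group `G`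
on `X`: it satisfies `T(gh; x) = T(g; h · x) T(h; x)`. -/
def IsSLCocycle {G X : Type*} [AddGroup G] (act : G → X → X) (T : G → X → MatFun) : Prop :=
  (∀ g x, T g x ∈ SLset) ∧
    ∀ g h x z, T (g + h) x z = T g (act h x) z * T h x z

/-- The one step transfer matrix `A(J)`. -/
def transferA (J : Jac) : MatFun := fun z =>
  !![(z - (coeffB J 1 : ℂ)) / (coeffA J 1 : ℂ), 1 / (coeffA J 1 : ℂ);
     -(coeffA J 1 : ℂ), 0]

/-- `A((n-1) · J) ⋯ A(J)`. -/
def transferNat : ℕ → Jac → MatFun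
  | 0, _ => fun _ => 1
  | n + 1, J => fun z => transferA (shift (n : ℤ) J) z * transferNat n J z

/-- The shift cocycle: `T(n; J) = A((n-1) · J) ⋯ A(J)` for `n ≥ 0`, and
`T(n; J) = T(-n; n · J)⁻¹` for `n < 0`. -/
def shiftCocycle (n : ℤ) (J : Jac) : MatFun := fun z =>
  if 0 ≤ n then transferNat n.toNat J z else (transferNat (-n).toNat (shift n J) z)⁻¹

/-- `Y` solves `Y'(t) = B(t · J)(z) Y(t)`, `Y(0) = 1` (the derivative is taken entrywise). -/
def IsFlowODESolution (f : ℝ → ℝ) (B : Jac → MatFun) (J : Jac) (z : ℂ)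
    (Y : ℝ → Matrix (Fin 2) (Fin 2) ℂ) : Prop :=
  Y 0 = 1 ∧ ∀ t i j, HasDerivAt (fun s => Y s i j) ((B (flow f t J) z * Y t) i j) t

open Classical in
/-- `T(t; J)`, the solution of `T' = B(t · J) T`, `T(0) = 1`. (For continuous `B` this linear
equation has exactly one solution for each `z`; the second branch is a dummy value.) -/
def flowCocycle (f : ℝ → ℝ) (B : Jac → MatFun) (t : ℝ) (J : Jac) : MatFun := fun z =>
  if h : ∃ Y, IsFlowODESolution f B J z Y then h.choose t else 1

/-- The glued function `T((t,n); J) = T(t; n · J) T(n; J)`. -/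
def glued (f : ℝ → ℝ) (B : Jac → MatFun) (g : ℝ × ℤ) (J : Jac) : MatFun := fun z =>
  flowCocycle f B g.1 (shift g.2 J) z * shiftCocycle g.2 J z

/-- The zero curvature equation: `(d/dt) A(t · J)` at `t = 0` exists and equals
`B(1 · J) A(J) - A(J) B(J)`, for every `J`, where `1 · J` is the shift of `J` by one. -/
def ZeroCurvature (f : ℝ → ℝ) (B : Jac → MatFun) : Prop :=
  ∀ (J : Jac) (z : ℂ) (i j : Fin 2),
    HasDerivAt (fun t => transferA (flow f t J) z i j)
      ((B (shift 1 J) z * transferA J z - transferA J z * B J z) i j) 0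

end Toda

end

/-! The shift cocycle satisfies its identity by construction, and `T(t; J)` satisfies its own over
the flow because solutions of linear equations are unique. For the glued function everything
therefore reduces to the exchange relation `T(t; m·J) T(m; J) = T(m; t·J) T(t; J)`, and by induction
on `m` to the case `m = 1`: (*) `T(t; 1·J) A(J) = A(t·J) T(t; J)`. If the glued function is a
cocycle, splitting `(t, 1)` as `(0, 1) + (t, 0)` gives (*); solving for `A(t·J)` and differentiating
at `t = 0` gives zero curvature (`FlowData.zeroCurvature`). Conversely, zero curvature along the
orbit gives the derivative of `A(t·J)`, and then both sides of (*) solve `Y' = B(t·(1·J)) Y` with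
`Y(0) = A(J)` (`FlowData.flowCocycle_mul_transferA`).

Both arguments need a genuine Toda flow: global, unique, a group action, commuting with the shift.
In the coefficients `(a, b)`, and with `F = f(J)`, the Lax equation becomes `a_n' = a_n (F_{n+1,n+1}
- F_{n,n})`, `b_n' = 2 (a_n F_{n,n+1} - a_{n-1} F_{n-1,n})` (`laxEntry_eq`), an ordinary
differential equation in a Banach space. Its right side is locally Lipschitz because `C²` functions
are operator Lipschitz on bounded sets (`OperatorLipschitz.exists_norm_cfc_sub_le`). Solutions are
global because the operator norm does not grow: for polynomial `f` the field is a commutator with a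
bounded skew-adjoint operator, which preserves the norm to first order, and general `f` is reached
by approximation. Gronwall keeps `a_n` positive.

That `T(t; J)` is entire in `z` follows by solving the linear equation with entries in the disk
algebra. -/

/-! ### Global solutions of ordinary differential equations -/

namespace GlobalODE

open Set Metric
open scoped NNReal

variable {E : Type*} [NormedAddCommGroup E]

/-- A Lipschitz cutoff function which is `1` on the ball of radius `R` and vanishes outside the
ball of radius `R + 1`. -/
noncomputable def cutoff (R : ℝ) (x : E) : ℝ := max 0 (min 1 (R + 1 - ‖x‖))

theorem cutoff_nonneg (R : ℝ) (x : E) : 0 ≤ cutoff R x := le_max_left _ _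

theorem cutoff_le_one (R : ℝ) (x : E) : cutoff R x ≤ 1 :=
  max_le zero_le_one (min_le_left _ _)

theorem cutoff_eq_one {R : ℝ} {x : E} (h : ‖x‖ ≤ R) : cutoff R x = 1 := by
  rw [cutoff, min_eq_left (by linarith), max_eq_right zero_le_one]

theorem cutoff_eq_zero {R : ℝ} {x : E} (h : R + 1 ≤ ‖x‖) : cutoff R x = 0 := by
  rw [cutoff, max_eq_left]
  exact (min_le_right _ _).trans (by linarith)

theorem abs_cutoff_sub_le (R : ℝ) (x y : E) : |cutoff R x - cutoff R y| ≤ ‖x - y‖ := by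
  have h1 := abs_max_sub_max_le_max 0 (min 1 (R + 1 - ‖x‖)) 0 (min 1 (R + 1 - ‖y‖))
  have h2 := abs_min_sub_min_le_max 1 (R + 1 - ‖x‖) 1 (R + 1 - ‖y‖)
  have h3 := abs_norm_sub_norm_le y x
  rw [norm_sub_rev] at h3
  replace h1 := h1.trans (max_le (by simp) le_rfl)
  replace h2 := h2.trans (max_le (by simp) le_rfl)
  have h4 : R + 1 - ‖x‖ - (R + 1 - ‖y‖) = ‖y‖ - ‖x‖ := by ring
  rw [h4] at h2
  exact h1.trans (h2.trans h3)

theorem norm_le_of_lipschitzOnWith {T R : ℝ} (hR : 0 ≤ R) {K : ℝ≥0} {v : ℝ → E → E}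
    (hc : ∀ x, Continuous fun t => v t x)
    (hK : ∀ t ∈ Icc (-T) T, LipschitzOnWith K (v t) (closedBall 0 R)) :
    ∃ M : ℝ≥0, ∀ t ∈ Icc (-T) T, ∀ x, ‖x‖ ≤ R → ‖v t x‖ ≤ M := by
  obtain ⟨M, hM⟩ := (isCompact_Icc (a := -T) (b := T)).exists_bound_of_continuousOn
    (hc 0).continuousOn
  refine ⟨(max M 0).toNNReal + K * R.toNNReal, fun t ht x hx => ?_⟩
  have h1 := (hK t ht).norm_sub_le (x := x) (y := 0) (by simpa using hx) (by simpa using hR)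
  have h2 := hM t ht
  have h3 : ‖v t x‖ ≤ ‖v t 0‖ + ‖v t x - v t 0‖ := by
    simpa using norm_add_le (v t 0) (v t x - v t 0)
  rw [sub_zero] at h1
  have h4 : (K : ℝ) * ‖x‖ ≤ K * R := mul_le_mul_of_nonneg_left hx K.2
  rw [NNReal.coe_add, NNReal.coe_mul, Real.coe_toNNReal _ (le_max_right _ _),
    Real.coe_toNNReal _ hR]
  linarith [le_max_left M 0]

variable [NormedSpace ℝ E]

theorem norm_cutoff_smul_le {R M : ℝ} {w : E → E} (hM0 : 0 ≤ M)
    (hM : ∀ x, ‖x‖ ≤ R + 1 → ‖w x‖ ≤ M) (x : E) : ‖cutoff R x • w x‖ ≤ M := by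
  by_cases h : ‖x‖ ≤ R + 1
  · rw [norm_smul, Real.norm_of_nonneg (cutoff_nonneg R x)]
    calc cutoff R x * ‖w x‖ ≤ 1 * M :=
          mul_le_mul (cutoff_le_one R x) (hM x h) (norm_nonneg _) zero_le_one
      _ = M := one_mul M
  · rw [cutoff_eq_zero (not_le.1 h).le, zero_smul, norm_zero]
    exact hM0

/-- Outside the ball of radius `R + 1` the product vanishes, so control of `w` on that ball gives a
global Lipschitz constant. -/
theorem lipschitzWith_cutoff_smul {R : ℝ} {M K : ℝ≥0} {w : E → E}
    (hM : ∀ x, ‖x‖ ≤ R + 1 → ‖w x‖ ≤ M)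
    (hK : LipschitzOnWith K w (closedBall 0 (R + 1))) :
    LipschitzWith (M + K) fun x => cutoff R x • w x := by
  -- Only one of the two points needs to lie in the ball; by symmetry this leaves the trivial case
  -- where both lie outside.
  have key : ∀ x y : E, ‖x‖ ≤ R + 1 →
      ‖cutoff R x • w x - cutoff R y • w y‖ ≤ (M + K) * ‖x - y‖ := by
    intro x y hx
    have e : cutoff R x • w x - cutoff R y • w y
        = (cutoff R x - cutoff R y) • w x + cutoff R y • (w x - w y) := by
      rw [sub_smul, smul_sub]; abel
    have h1 : ‖(cutoff R x - cutoff R y) • w x‖ ≤ ‖x - y‖ * M := by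
      rw [norm_smul]
      exact mul_le_mul (abs_cutoff_sub_le R x y) (hM x hx) (norm_nonneg _) (norm_nonneg _)
    have h2 : ‖cutoff R y • (w x - w y)‖ ≤ K * ‖x - y‖ := by
      by_cases hy : ‖y‖ ≤ R + 1
      · rw [norm_smul, Real.norm_of_nonneg (cutoff_nonneg R y)]
        have h3 := hK.norm_sub_le (by simpa using hx) (by simpa using hy)
        calc cutoff R y * ‖w x - w y‖ ≤ 1 * (K * ‖x - y‖) :=
              mul_le_mul (cutoff_le_one R y) h3 (norm_nonneg _) zero_le_one
          _ = K * ‖x - y‖ := one_mul _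
      · rw [cutoff_eq_zero (not_le.1 hy).le, zero_smul, norm_zero]
        positivity
    rw [e]
    calc _ ≤ _ := norm_add_le _ _
      _ ≤ ‖x - y‖ * M + K * ‖x - y‖ := add_le_add h1 h2
      _ = (M + K) * ‖x - y‖ := by ring
  refine LipschitzWith.of_dist_le_mul fun x y => ?_
  rw [dist_eq_norm, dist_eq_norm, NNReal.coe_add]
  by_cases hx : ‖x‖ ≤ R + 1
  · exact key x y hx
  by_cases hy : ‖y‖ ≤ R + 1
  · rw [norm_sub_rev, norm_sub_rev x]
    exact key y x hy
  · simp only [cutoff_eq_zero (not_le.1 hx).le, cutoff_eq_zero (not_le.1 hy).le, zero_smul,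
      sub_self, norm_zero]
    positivity

/-- Two solutions of an ordinary differential equation with locally Lipschitz right hand side
on a symmetric interval agree. -/
theorem eqOn_Ioo {T : ℝ} {v : ℝ → E → E}
    (hL : ∀ R, ∃ K : ℝ≥0, ∀ t ∈ Icc (-R) R, LipschitzOnWith K (v t) (closedBall 0 R))
    {α β : ℝ → E} (h0 : α 0 = β 0) (hα : ∀ t ∈ Ioo (-T) T, HasDerivAt α (v t (α t)) t)
    (hβ : ∀ t ∈ Ioo (-T) T, HasDerivAt β (v t (β t)) t) : EqOn α β (Ioo (-T) T) := by
  intro t ht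
  -- On the smaller compact interval both solutions are bounded, so one Lipschitz constant serves
  -- for both.
  obtain ⟨S, hS1, hS2⟩ : ∃ S, |t| < S ∧ S < T := exists_between (abs_lt.2 ht)
  have hS0 : 0 < S := (abs_nonneg t).trans_lt hS1
  have hsub : Icc (-S) S ⊆ Ioo (-T) T := fun s hs => ⟨by linarith [hs.1], by linarith [hs.2]⟩
  obtain ⟨C, hC⟩ := (isCompact_Icc (a := -S) (b := S)).exists_bound_of_continuousOn
    (f := α) fun s hs => (hα s (hsub hs)).continuousAt.continuousWithinAt
  obtain ⟨D, hD⟩ := (isCompact_Icc (a := -S) (b := S)).exists_bound_of_continuousOn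
    (f := β) fun s hs => (hβ s (hsub hs)).continuousAt.continuousWithinAt
  obtain ⟨K, hK⟩ := hL (max S (max C D))
  have hle : S ≤ max S (max C D) := le_max_left _ _
  refine ODE_solution_unique_of_mem_Ioo (v := v) (s := fun _ => closedBall 0 (max S (max C D)))
    (K := K) (a := -S) (b := S) (t₀ := 0) ?_ ⟨by linarith, hS0⟩ ?_ ?_ h0 (abs_lt.1 hS1)
  · exact fun s hs => hK s ⟨by linarith [hs.1], by linarith [hs.2]⟩
  · intro s hs
    refine ⟨hα s (hsub (Ioo_subset_Icc_self hs)), ?_⟩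
    rw [mem_closedBall_zero_iff]
    exact (hC s (Ioo_subset_Icc_self hs)).trans ((le_max_left _ _).trans (le_max_right _ _))
  · intro s hs
    refine ⟨hβ s (hsub (Ioo_subset_Icc_self hs)), ?_⟩
    rw [mem_closedBall_zero_iff]
    exact (hD s (Ioo_subset_Icc_self hs)).trans ((le_max_right _ _).trans (le_max_right _ _))

/-- Two global solutions of an ordinary differential equation with locally Lipschitz right hand
side agree. -/
theorem eq_of_hasDerivAt {v : ℝ → E → E}
    (hL : ∀ R, ∃ K : ℝ≥0, ∀ t ∈ Icc (-R) R, LipschitzOnWith K (v t) (closedBall 0 R))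
    {α β : ℝ → E} (h0 : α 0 = β 0) (hα : ∀ t, HasDerivAt α (v t (α t)) t)
    (hβ : ∀ t, HasDerivAt β (v t (β t)) t) : α = β := by
  funext t
  exact eqOn_Ioo (T := |t| + 1) hL h0 (fun s _ => hα s) (fun s _ => hβ s)
    (abs_lt.1 (lt_add_one _))

/-- Gronwall's inequality in both time directions; negative times follow by reflection. -/
theorem norm_le_of_norm_deriv_le {M T : ℝ} {α α' : ℝ → E}
    (hα : ∀ t ∈ Ioo (-T) T, HasDerivAt α (α' t) t) (hM : ∀ t ∈ Ioo (-T) T, ‖α' t‖ ≤ M * ‖α t‖)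
    {t : ℝ} (ht : t ∈ Ioo (-T) T) : ‖α t‖ ≤ ‖α 0‖ * Real.exp (M * |t|) := by
  have key : ∀ (γ γ' : ℝ → E), (∀ t ∈ Ioo (-T) T, HasDerivAt γ (γ' t) t) →
      (∀ t ∈ Ioo (-T) T, ‖γ' t‖ ≤ M * ‖γ t‖) → ∀ t ∈ Ioo (-T) T, 0 ≤ t →
      ‖γ t‖ ≤ ‖γ 0‖ * Real.exp (M * t) := by
    intro γ γ' hγ hγ' t ht h0
    have hsub : Icc 0 t ⊆ Ioo (-T) T := fun s hs =>
      ⟨by linarith [hs.1, ht.1, ht.2], by linarith [hs.2, ht.2]⟩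
    have := norm_le_gronwallBound_of_norm_deriv_right_le (f := γ) (f' := γ') (δ := ‖γ 0‖) (K := M)
      (ε := 0) (a := 0) (b := t)
      (fun s hs => (hγ s (hsub hs)).continuousAt.continuousWithinAt)
      (fun s hs => (hγ s (hsub (Ico_subset_Icc_self hs))).hasDerivWithinAt) le_rfl
      (fun s hs => by simpa using hγ' s (hsub (Ico_subset_Icc_self hs))) t ⟨h0, le_rfl⟩
    rwa [gronwallBound_ε0, sub_zero] at this
  rcases le_total 0 t with h | h
  · rw [abs_of_nonneg h]
    exact key α α' hα hM t ht h
  · rw [abs_of_nonpos h]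
    have hneg : ∀ s ∈ Ioo (-T) T, -s ∈ Ioo (-T) T := fun s hs =>
      ⟨by linarith [hs.2], by linarith [hs.1]⟩
    have := key (fun s => α (-s)) (fun s => -α' (-s))
      (fun s hs => by
        simpa [Function.comp_def] using (hα (-s) (hneg s hs)).scomp s (hasDerivAt_neg s))
      (fun s hs => by simpa using hM (-s) (hneg s hs)) (-t) (hneg t ht) (by linarith)
    simpa using this

variable [CompleteSpace E]

/-- The field with the cutoff is bounded by some `M`, so in time `T` no solution leaves the ball of
radius `M * T`, and one application of Picard-Lindelöf covers the whole interval. -/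
theorem exists_hasDerivAt_Ioo_of_cutoff {T R : ℝ} (hT : 0 < T) (hR : 0 ≤ R) {v : ℝ → E → E}
    (hc : ∀ x, Continuous fun t => v t x)
    (hL : ∀ R, ∃ K : ℝ≥0, ∀ t ∈ Icc (-R) R, LipschitzOnWith K (v t) (closedBall 0 R))
    (x₀ : E) : ∃ α : ℝ → E, α 0 = x₀ ∧
      ∀ t ∈ Ioo (-T) T, HasDerivAt α (cutoff R (α t) • v t (α t)) t := by
  obtain ⟨K, hK⟩ := hL (max T (R + 1))
  have hK' : ∀ t ∈ Icc (-T) T, LipschitzOnWith K (v t) (closedBall 0 (R + 1)) := fun t ht =>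
    (hK t ⟨by linarith [ht.1, le_max_left T (R + 1)],
      ht.2.trans (le_max_left _ _)⟩).mono (closedBall_subset_closedBall (le_max_right _ _))
  obtain ⟨M, hM⟩ := norm_le_of_lipschitzOnWith (R := R + 1) (by linarith) hc hK'
  let w : ℝ → E → E := fun t x => cutoff R x • v t x
  have hP : IsPicardLindelof w (tmin := -T) (tmax := T) ⟨0, by constructor <;> linarith⟩ x₀
      (M * T.toNNReal) 0 M (M + K) :=
    { lipschitzOnWith := fun t ht =>
        (lipschitzWith_cutoff_smul (hM t ht) (hK' t ht)).lipschitzOnWith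
      continuousOn := fun x _ => ((hc x).const_smul _).continuousOn
      norm_le := fun t ht x _ => norm_cutoff_smul_le M.2 (hM t ht) x
      mul_max_le := by
        simp [Real.coe_toNNReal _ hT.le] }
  obtain ⟨α, h0, hα⟩ := hP.exists_eq_forall_mem_Icc_hasDerivWithinAt₀
  exact ⟨α, h0, fun t ht => (hα t (Ioo_subset_Icc_self ht)).hasDerivAt (Icc_mem_nhds ht.1 ht.2)⟩

/-- Global existence for an ordinary differential equation with locally Lipschitz right hand side,
under an a priori bound that is insensitive to multiplying the right hand side by a cutoff
function. -/
theorem exists_hasDerivAt {v : ℝ → E → E} (hc : ∀ x, Continuous fun t => v t x)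
    (hL : ∀ R, ∃ K : ℝ≥0, ∀ t ∈ Icc (-R) R, LipschitzOnWith K (v t) (closedBall 0 R))
    (x₀ : E)
    (hb : ∀ T, 0 < T → ∃ R, 0 ≤ R ∧ ∀ (c : ℝ → ℝ) (α : ℝ → E), (∀ t, 0 ≤ c t ∧ c t ≤ 1) →
      α 0 = x₀ → (∀ t ∈ Ioo (-T) T, HasDerivAt α (c t • v t (α t)) t) →
      ∀ t ∈ Ioo (-T) T, ‖α t‖ ≤ R) :
    ∃ α : ℝ → E, α 0 = x₀ ∧ ∀ t, HasDerivAt α (v t (α t)) t := by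
  have h1 : ∀ T : ℝ, ∃ α : ℝ → E, α 0 = x₀ ∧
      ∀ t ∈ Ioo (-T) T, HasDerivAt α (v t (α t)) t := by
    intro T
    by_cases hT : 0 < T
    · obtain ⟨R, hR, hRb⟩ := hb T hT
      obtain ⟨α, h0, hα⟩ := exists_hasDerivAt_Ioo_of_cutoff hT hR hc hL x₀
      -- The factor `cutoff R (α t)` is an admissible `c t`, so the a priori bound keeps `α` where
      -- the cutoff equals `1`.
      have hle := hRb (fun t => cutoff R (α t)) α
        (fun t => ⟨cutoff_nonneg R _, cutoff_le_one R _⟩) h0 hα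
      refine ⟨α, h0, fun t ht => ?_⟩
      have := hα t ht
      rwa [cutoff_eq_one (hle t ht), one_smul] at this
    · exact ⟨fun _ => x₀, rfl, fun t ht => absurd (ht.1.trans ht.2) (by linarith)⟩
  choose β hβ0 hβ using h1
  have hag : ∀ S T t : ℝ, |t| < S → |t| < T → β S t = β T t := by
    intro S T t hS hT
    have hm : |t| < min S T := lt_min hS hT
    exact eqOn_Ioo (T := min S T) hL ((hβ0 S).trans (hβ0 T).symm)
      (fun s hs => hβ S s ⟨by linarith [hs.1, min_le_left S T], by linarith [hs.2, min_le_left S T]⟩)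
      (fun s hs => hβ T s ⟨by linarith [hs.1, min_le_right S T], by linarith [hs.2, min_le_right S T]⟩)
      (abs_lt.1 hm)
  refine ⟨fun t => β (|t| + 1) t, hβ0 _, fun t => ?_⟩
  -- The glued function uses a different local solution at each time; near `t` they all agree with
  -- the fixed one on the interval of radius `|t| + 2`.
  have h2 := hβ (|t| + 2) t (abs_lt.1 (by linarith))
  beta_reduce
  rw [hag (|t| + 1) (|t| + 2) t (by linarith) (by linarith)]
  refine h2.congr_of_eventuallyEq ?_
  have h3 : ∀ᶠ s in 𝓝 t, |s| < |t| + 2 :=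
    continuous_abs.continuousAt.eventually_lt continuousAt_const (by linarith)
  filter_upwards [h3] with s hs
  exact hag _ _ s (by linarith) hs

end GlobalODE

/-! ### `C²` functions are operator Lipschitz on bounded sets -/

namespace OperatorLipschitz

open Complex NormedSpace Set

/-! ### Exponentials and trigonometric series of self-adjoint elements. -/

section Exponential

variable {A : Type*} [CStarAlgebra A]

theorem exp_real_smul_mem_unitary {J : A} (hJ : IsSelfAdjoint J) (t : ℝ) :
    exp (t • (I • J)) ∈ unitary A := by
  have h : IsSelfAdjoint (t • J) := (IsSelfAdjoint.all _).smul hJ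
  have e : t • (I • J) = I • (t • J) := smul_comm t I J
  rw [e]
  exact (selfAdjoint.expUnitary ⟨t • J, h⟩).2

/-- Duhamel's argument: the path `exp(itJ) exp(i(1-t)K)` joins the two exponentials, and its
derivative is `i(J - K)` between two unitaries. -/
theorem norm_exp_sub_exp_le {J K : A} (hJ : IsSelfAdjoint J) (hK : IsSelfAdjoint K) :
    ‖exp (I • J) - exp (I • K)‖ ≤ ‖J - K‖ := by
  let γ : ℝ → A := fun t => exp (t • (I • J)) * exp ((1 - t) • (I • K))
  have hγ : ∀ t : ℝ, HasDerivAt γ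
      (exp (t • (I • J)) * (I • J - I • K) * exp ((1 - t) • (I • K))) t := by
    intro t
    have h1 := hasDerivAt_exp_smul_const (𝕂 := ℝ) (I • J) t
    have h2 := (hasDerivAt_exp_smul_const' (𝕂 := ℝ) (I • K) (1 - t)).scomp t
      ((hasDerivAt_id t).const_sub 1)
    refine (h1.mul h2).congr_deriv ?_
    rw [neg_one_smul]
    simp only [Function.comp_apply]
    noncomm_ring
  have hb : ∀ t : ℝ,
      ‖exp (t • (I • J)) * (I • J - I • K) * exp ((1 - t) • (I • K))‖ ≤ ‖J - K‖ := by
    intro t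
    have h1 := CStarRing.norm_mul_coe_unitary (exp (t • (I • J)) * (I • J - I • K))
      ⟨_, exp_real_smul_mem_unitary hK (1 - t)⟩
    have h2 := CStarRing.norm_coe_unitary_mul ⟨_, exp_real_smul_mem_unitary hJ t⟩
      (I • J - I • K)
    simp only at h1 h2
    rw [h1, h2, ← smul_sub, norm_smul, norm_I, one_mul]
  have := norm_image_sub_le_of_norm_deriv_le_segment_01' (f := γ)
    (fun t _ => (hγ t).hasDerivWithinAt) (fun t _ => hb t)
  simpa [γ] using this

theorem cfc_exp_mul {J : A} (hJ : IsSelfAdjoint J) (s : ℝ) :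
    cfc (fun z : ℂ => Complex.exp (I * s * z)) J = exp (I • (s • J)) := by
  have hn : IsStarNormal J := hJ.isStarNormal
  have hn' : IsStarNormal ((I * s : ℂ) • J) := by
    refine ⟨?_⟩
    rw [star_smul, hJ.star_eq]
    exact ((Commute.refl J).smul_left _).smul_right _
  rw [cfc_comp_const_mul (I * s : ℂ) Complex.exp J (by fun_prop) hn,
    CFC.complex_exp_eq_normedSpace_exp hn', mul_smul, Complex.coe_smul]

theorem norm_cfc_exp_mul_sub_le {J K : A} (hJ : IsSelfAdjoint J) (hK : IsSelfAdjoint K) (s : ℝ) :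
    ‖cfc (fun z : ℂ => Complex.exp (I * s * z)) J - cfc (fun z : ℂ => Complex.exp (I * s * z)) K‖
      ≤ |s| * ‖J - K‖ := by
  rw [cfc_exp_mul hJ, cfc_exp_mul hK]
  refine (norm_exp_sub_exp_le ((IsSelfAdjoint.all _).smul hJ)
    ((IsSelfAdjoint.all _).smul hK)).trans ?_
  rw [← smul_sub, norm_smul, Real.norm_eq_abs]

variable [Nontrivial A]

/-- The spectrum is real and contained in `[-R, R]`, where the absolutely summable series converges
uniformly; the functional calculus respects uniform convergence on the spectrum. -/
theorem tendsto_cfc_trigonometric {ι : Type*} {f : ℝ → ℝ} {R : ℝ} {c : ι → ℂ} {ω : ι → ℝ}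
    (hc : Summable fun n => ‖c n‖)
    (hf : ∀ x ∈ Icc (-R) R, HasSum (fun n => c n * Complex.exp (I * ω n * x)) (f x))
    {J : A} (hJ : IsSelfAdjoint J) (hR : ‖J‖ ≤ R) :
    Tendsto (fun s : Finset ι => ∑ n ∈ s, c n • cfc (fun z : ℂ => Complex.exp (I * ω n * z)) J)
      atTop (𝓝 (cfc f J)) := by
  have hn : IsStarNormal J := hJ.isStarNormal
  have hre : ∀ z ∈ spectrum ℂ J, (z.re : ℂ) = z ∧ z.re ∈ Icc (-R) R := by
    intro z hz
    refine ⟨(hJ.mem_spectrum_eq_re hz).symm, ?_⟩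
    exact abs_le.1 ((abs_re_le_norm z).trans ((spectrum.norm_le_norm_of_mem hz).trans hR))
  have hu : TendstoUniformlyOn
      (fun (s : Finset ι) (z : ℂ) => ∑ n ∈ s, c n * Complex.exp (I * ω n * z))
      (fun z => ((f z.re : ℝ) : ℂ)) atTop (spectrum ℂ J) := by
    refine (tendstoUniformlyOn_tsum (f := fun n (z : ℂ) => c n * Complex.exp (I * ω n * z)) hc
      (s := spectrum ℂ J) fun n z hz => ?_).congr_right fun z hz => ?_
    · rw [← (hre z hz).1, norm_mul]
      have : (I * ω n * z.re : ℂ) = ((ω n * z.re : ℝ) : ℂ) * I := by push_cast; ring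
      rw [this, norm_exp_ofReal_mul_I, mul_one]
    · have := (hf z.re (hre z hz).2).tsum_eq
      rwa [(hre z hz).1] at this
  have ht := tendsto_cfc_fun hu (Eventually.of_forall fun s => by fun_prop)
  rw [cfc_real_eq_complex f hJ]
  refine ht.congr fun s => ?_
  have e : (fun z : ℂ => ∑ n ∈ s, c n * Complex.exp (I * ω n * z))
      = ∑ n ∈ s, fun z : ℂ => c n * Complex.exp (I * ω n * z) := by
    ext z; simp
  rw [e, cfc_sum _ _ _ fun n _ => by fun_prop]
  exact Finset.sum_congr rfl fun n _ => cfc_const_mul _ _ _ (by fun_prop)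

theorem norm_cfc_sub_le_of_trigonometric {ι : Type*} {f : ℝ → ℝ} {R : ℝ} {c : ι → ℂ} {ω : ι → ℝ}
    (hc : Summable fun n => ‖c n‖) (hω : Summable fun n => ‖c n‖ * |ω n|)
    (hf : ∀ x ∈ Icc (-R) R, HasSum (fun n => c n * Complex.exp (I * ω n * x)) (f x))
    {J K : A} (hJ : IsSelfAdjoint J) (hK : IsSelfAdjoint K) (hJR : ‖J‖ ≤ R) (hKR : ‖K‖ ≤ R) :
    ‖cfc f J - cfc f K‖ ≤ (∑' n, ‖c n‖ * |ω n|) * ‖J - K‖ := by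
  have ht := (tendsto_cfc_trigonometric hc hf hJ hJR).sub (tendsto_cfc_trigonometric hc hf hK hKR)
  refine le_of_tendsto ht.norm (Eventually.of_forall fun s => ?_)
  rw [← Finset.sum_sub_distrib]
  refine (norm_sum_le _ _).trans ?_
  calc _ ≤ ∑ n ∈ s, ‖c n‖ * |ω n| * ‖J - K‖ := by
        refine Finset.sum_le_sum fun n _ => ?_
        rw [← smul_sub, norm_smul, mul_assoc]
        exact mul_le_mul_of_nonneg_left (norm_cfc_exp_mul_sub_le hJ hK _) (norm_nonneg _)
    _ = (∑ n ∈ s, ‖c n‖ * |ω n|) * ‖J - K‖ := by rw [Finset.sum_mul]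
    _ ≤ _ := mul_le_mul_of_nonneg_right (hω.sum_le_tsum s fun _ _ => by positivity)
        (norm_nonneg _)

end Exponential

/-! ### Fourier series of `C²` functions. -/

section Fourier

/-- The Fourier coefficients of a `C²` function vanishing near the ends of an interval are
absolutely summable with weight `|n|`. -/
theorem summable_fourierCoeffOn_mul {a b : ℝ} (hab : a < b) {g g₁ g₂ : ℝ → ℂ}
    (h1 : ∀ x, HasDerivAt g (g₁ x) x) (h2 : ∀ x, HasDerivAt g₁ (g₂ x) x) (h3 : Continuous g₂)
    (ha : g a = 0) (hb : g b = 0) (ha₁ : g₁ a = 0) (hb₁ : g₁ b = 0) :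
    Summable fun n : ℤ => ‖fourierCoeffOn hab g n‖ * |(n : ℝ)| := by
  have hg₁ : Continuous g₁ := continuous_iff_continuousAt.2 fun x => (h2 x).continuousAt
  have hL2 : MeasureTheory.MemLp g₂ 2 (MeasureTheory.volume.restrict (Ioc a b)) := by
    obtain ⟨C, hC⟩ := (isCompact_Icc (a := a) (b := b)).exists_bound_of_continuousOn
      h3.continuousOn
    refine MeasureTheory.MemLp.of_bound h3.aestronglyMeasurable C ?_
    filter_upwards [MeasureTheory.ae_restrict_mem measurableSet_Ioc] with x hx
    exact hC x (Ioc_subset_Icc_self hx)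
  have hs := (hasSum_sq_fourierCoeffOn hab hL2).summable
  have hn2 : Summable fun n : ℤ => 1 / (n : ℝ) ^ 2 := Real.summable_one_div_int_pow.2 one_lt_two
  refine Summable.of_nonneg_of_le (fun n => by positivity) (fun n => ?_)
    ((hs.add hn2).mul_left (((b - a) / (2 * Real.pi)) ^ 2))
  by_cases hn : n = 0
  · subst hn; simp only [Int.cast_zero, abs_zero, mul_zero]; positivity
  -- Two integrations by parts without boundary terms: up to a constant, the coefficient of `g` is
  -- that of `g₂` divided by `n²`.
  have e1 := fourierCoeffOn_of_hasDerivAt hab hn (fun x _ => h1 x) (hg₁.intervalIntegrable a b)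
  have e2 := fourierCoeffOn_of_hasDerivAt hab hn (fun x _ => h2 x) (h3.intervalIntegrable a b)
  rw [ha, hb, sub_zero, mul_zero, zero_sub] at e1
  rw [ha₁, hb₁, sub_zero, mul_zero, zero_sub] at e2
  have hn' : 0 < |(n : ℝ)| := abs_pos.2 (Int.cast_ne_zero.2 hn)
  have hπ := Real.pi_pos
  have hba : 0 < b - a := sub_pos.2 hab
  have nrm : ∀ w : ℂ, ‖(1 / (-2 * (Real.pi : ℂ) * I * n) * -((b - a) * w) : ℂ)‖
      = (b - a) / (2 * Real.pi) * ‖w‖ / |(n : ℝ)| := by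
    intro w
    have : ‖((b : ℂ) - a)‖ = b - a := by
      rw [← ofReal_sub, norm_real, Real.norm_of_nonneg hba.le]
    have h4 : ‖(n : ℂ)‖ = |(n : ℝ)| := by
      rw [← Complex.ofReal_intCast, norm_real, Real.norm_eq_abs]
    simp only [norm_mul, norm_div, this, h4, norm_one, norm_neg, norm_ofNat, norm_real, norm_I,
      Real.norm_of_nonneg hπ.le]
    field_simp
  rw [e1, nrm, e2, nrm]
  set y := ‖fourierCoeffOn hab g₂ n‖
  -- One factor `1/|n|` survives the weight. Both `y²` and `1/n²` are summable, the first by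
  -- Parseval.
  have h5 : y * (1 / |(n : ℝ)|) ≤ y ^ 2 + 1 / (n : ℝ) ^ 2 := by
    have h6 : (1 : ℝ) / (n : ℝ) ^ 2 = (1 / |(n : ℝ)|) ^ 2 := by rw [div_pow, one_pow, sq_abs]
    rw [h6]
    nlinarith [sq_nonneg (y - 1 / |(n : ℝ)|), sq_nonneg y, sq_nonneg (1 / |(n : ℝ)|)]
  calc _ = ((b - a) / (2 * Real.pi)) ^ 2 * (y * (1 / |(n : ℝ)|)) := by field_simp
    _ ≤ _ := mul_le_mul_of_nonneg_left h5 (by positivity)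

/-- On a bounded interval, a `C²` function is a trigonometric series whose coefficients are
summable with the frequencies as weights. -/
theorem exists_trigonometric_series {f : ℝ → ℝ} (hf : ContDiff ℝ 2 f) {R : ℝ} (hR : 0 ≤ R) :
    ∃ (c : ℤ → ℂ) (ω : ℤ → ℝ), (Summable fun n => ‖c n‖) ∧ (Summable fun n => ‖c n‖ * |ω n|) ∧
      ∀ x ∈ Icc (-R) R, HasSum (fun n => c n * Complex.exp (I * ω n * x)) (f x) := by
  -- The support ends at `R + 2`, strictly inside the period interval with ends `±(R + 3)`, so the
  -- function and its derivative vanish at the ends.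
  let χ : ContDiffBump (0 : ℝ) := ⟨R + 1, R + 2, by linarith, by linarith⟩
  let g₀ : ℝ → ℝ := fun x => χ x * f x
  have hg₀ : ContDiff ℝ 2 g₀ := χ.contDiff.mul hf
  let g : ℝ → ℂ := fun x => (g₀ x : ℂ)
  have hg : ContDiff ℝ 2 g := ofRealCLM.contDiff.comp hg₀
  have hg1 : ContDiff ℝ 1 (deriv g) := by
    have : ContDiff ℝ (1 + 1) g := by simpa [one_add_one_eq_two] using hg
    exact (contDiff_succ_iff_deriv.1 this).2.2
  have hg2 : Continuous (deriv (deriv g)) := hg1.continuous_deriv le_rfl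
  have hz : ∀ x, R + 2 ≤ |x| → g x = 0 := by
    intro x hx
    have : χ x = 0 := χ.zero_of_le_dist (by simpa [Real.dist_eq] using hx)
    simp [g, g₀, this]
  have hz1 : ∀ x, R + 2 < |x| → deriv g x = 0 := by
    intro x hx
    have h : g =ᶠ[𝓝 x] fun _ => 0 := by
      filter_upwards [continuous_abs.continuousAt.eventually_const_lt hx] with y hy
      exact hz y hy.le
    rw [h.deriv_eq, deriv_const]
  have hT1 : R + 2 < |R + 3| := by rw [abs_of_nonneg (by linarith)]; linarith
  have hT2 : R + 2 < |-(R + 3)| := by rw [abs_neg]; exact hT1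
  have hab : -(R + 3) < R + 3 := by linarith
  have hs := summable_fourierCoeffOn_mul hab (g := g) (g₁ := deriv g) (g₂ := deriv (deriv g))
    (fun x => (hg.differentiable two_ne_zero).differentiableAt.hasDerivAt)
    (fun x => (hg1.differentiable one_ne_zero).differentiableAt.hasDerivAt) hg2
    (hz _ hT2.le) (hz _ hT1.le) (hz1 _ hT2) (hz1 _ hT1)
  set L : ℝ := R + 3 - -(R + 3) with hL
  have hL0 : 0 < L := by linarith
  have : Fact (0 < L) := ⟨hL0⟩
  have hend : -(R + 3) + L = R + 3 := by linarith
  let G : C(AddCircle L, ℂ) := ⟨AddCircle.liftIoc L (-(R + 3)) g,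
    AddCircle.liftIoc_continuous (by rw [hend, hz _ hT1.le, hz _ hT2.le])
      hg.continuous.continuousOn⟩
  have hGc : ∀ n, fourierCoeff G n = fourierCoeffOn hab g n := fun n => rfl
  have hc : Summable fun n => ‖fourierCoeffOn hab g n‖ := by
    -- The weight `|n|` loses the coefficient at `n = 0`, which is added back here.
    have h0 : Summable fun n : ℤ => if n = 0 then ‖fourierCoeffOn hab g 0‖ else 0 :=
      summable_of_hasFiniteSupport ((Set.finite_singleton (0 : ℤ)).subset fun n hn => by
        by_contra h
        exact hn (if_neg h))
    refine Summable.of_nonneg_of_le (fun n => norm_nonneg _) (fun n => ?_) (hs.add h0)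
    by_cases hn : n = 0
    · subst hn; simp
    · simp only [hn, if_false, add_zero]
      refine le_mul_of_one_le_right (norm_nonneg _) ?_
      exact_mod_cast Int.one_le_abs hn
  refine ⟨fun n => fourierCoeffOn hab g n, fun n => 2 * Real.pi / L * n, hc, ?_, fun x hx => ?_⟩
  · refine (hs.mul_left (2 * Real.pi / L)).congr fun n => ?_
    rw [abs_mul, abs_of_nonneg (by positivity : 0 ≤ 2 * Real.pi / L)]
    ring
  · have h := has_pointwise_sum_fourier_series_of_summable (f := G) (Summable.of_norm hc)
      (x : AddCircle L)
    have hGx : G (x : AddCircle L) = f x := by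
      have hx' : x ∈ Ioc (-(R + 3)) (-(R + 3) + L) := ⟨by linarith [hx.1], by linarith [hx.2]⟩
      have h1 : G (x : AddCircle L) = g x := AddCircle.liftIoc_coe_apply (f := g) hx'
      have h2 : χ x = 1 := χ.one_of_mem_closedBall (by
        rw [mem_closedBall_zero_iff, Real.norm_eq_abs]
        exact (abs_le.2 hx).trans (by linarith : R ≤ R + 1))
      rw [h1]
      simp [g, g₀, h2]
    rw [hGx] at h
    refine h.congr_fun fun n => ?_
    rw [hGc, fourier_coe_apply, smul_eq_mul]
    congr 2
    push_cast
    ring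

end Fourier

/-- This is where two derivatives of `f` are spent. The series depends only on `f` and `R`, so the
constant is uniform over the ball. -/
theorem exists_norm_cfc_sub_le {A : Type*} [CStarAlgebra A] [Nontrivial A] {f : ℝ → ℝ}
    (hf : ContDiff ℝ 2 f) {R : ℝ} (hR : 0 ≤ R) :
    ∃ C, 0 ≤ C ∧ ∀ J K : A, IsSelfAdjoint J → IsSelfAdjoint K → ‖J‖ ≤ R → ‖K‖ ≤ R →
      ‖cfc f J - cfc f K‖ ≤ C * ‖J - K‖ := by
  obtain ⟨c, ω, hc, hω, h⟩ := exists_trigonometric_series hf hR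
  exact ⟨∑' n, ‖c n‖ * |ω n|, tsum_nonneg fun n => by positivity,
    fun J K hJ hK hJR hKR => norm_cfc_sub_le_of_trigonometric hc hω h hJ hK hJR hKR⟩

end OperatorLipschitz

noncomputable section

/-! ### Jacobi matrices and their coefficients -/

namespace Toda

open BoundedContinuousFunction

theorem delta_apply (k j : ℤ) : delta k j = if j = k then 1 else 0 := by
  unfold delta
  split_ifs with h
  · subst h; exact lp.single_apply_self _ _ _
  · exact lp.single_apply_ne _ _ _ h

theorem norm_delta (k : ℤ) : ‖delta k‖ = 1 := by
  unfold delta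
  rw [lp.norm_single (by norm_num), norm_one]

theorem entry_eq (X : H →L[ℂ] H) (j k : ℤ) : entry X j k = X (delta k) j := by
  unfold entry
  conv_lhs => rw [delta, lp.inner_single_left]
  simp

theorem norm_entry_le (X : H →L[ℂ] H) (j k : ℤ) : ‖entry X j k‖ ≤ ‖X‖ := by
  rw [entry_eq]
  calc ‖X (delta k) j‖ ≤ ‖X (delta k)‖ := lp.norm_apply_le_norm two_ne_zero _ _
    _ ≤ ‖X‖ * ‖delta k‖ := X.le_opNorm _
    _ = ‖X‖ := by rw [norm_delta, mul_one]

theorem entry_add (X Y : H →L[ℂ] H) (j k : ℤ) : entry (X + Y) j k = entry X j k + entry Y j k := by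
  simp [entry_eq]

theorem entry_sub (X Y : H →L[ℂ] H) (j k : ℤ) : entry (X - Y) j k = entry X j k - entry Y j k := by
  simp [entry_eq]

theorem entry_real_smul (c : ℝ) (X : H →L[ℂ] H) (j k : ℤ) :
    entry (c • X) j k = c * entry X j k := by
  simp [entry_eq]

theorem entry_star (X : H →L[ℂ] H) (j k : ℤ) : entry (star X) j k = star (entry X k j) := by
  unfold entry
  rw [ContinuousLinearMap.star_eq_adjoint, ContinuousLinearMap.adjoint_inner_right]
  exact (inner_conj_symm _ _).symm

/-- The vectors `δ_k` span a dense subspace and the operators are continuous. -/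
theorem ext_entry {X Y : H →L[ℂ] H} (h : ∀ j k, entry X j k = entry Y j k) : X = Y := by
  have h1 : ∀ k, X (delta k) = Y (delta k) := fun k => lp.ext (funext fun j => by
    rw [← entry_eq, ← entry_eq, h])
  ext1 u
  have h2 := lp.hasSum_single (p := 2) (by norm_num) u
  have h3 : ∀ k, lp.single 2 k (u k) = u k • delta k := fun k => by
    unfold delta
    rw [← lp.single_smul, smul_eq_mul, mul_one]
  simp only [h3] at h2
  have hX := h2.mapL X
  have hY := h2.mapL Y
  simp only [map_smul, h1] at hX hY
  exact hX.unique hY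

theorem shiftOp_apply (n : ℤ) (u : H) (k : ℤ) : shiftOp n u k = u (k + n) := rfl

theorem memlp_mul (x : ℤ →ᵇ ℝ) (u : H) : Memℓp (fun k : ℤ => ((x k : ℂ) * u k : ℂ)) 2 := by
  refine ((lp.memℓp u).const_smul (‖x‖ : ℂ)).mono' fun k => ?_
  simp only [Pi.smul_apply, norm_smul, norm_mul, Complex.norm_real, norm_norm]
  exact mul_le_mul_of_nonneg_right (x.norm_coe_le_norm k) (norm_nonneg _)

/-- The diagonal operator with a given bounded real diagonal. -/
def diagOp (x : ℤ →ᵇ ℝ) : H →L[ℂ] H :=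
  LinearMap.mkContinuous
    { toFun := fun u => ⟨fun k => (x k : ℂ) * u k, memlp_mul x u⟩
      map_add' := fun u v => lp.ext (funext fun k => mul_add _ _ _)
      map_smul' := fun c u => lp.ext (funext fun k => mul_left_comm _ _ _) } ‖x‖ fun u => by
    have h : ‖(⟨fun k => (x k : ℂ) * u k, memlp_mul x u⟩ : H)‖ ≤ ‖(‖x‖ : ℂ) • u‖ := by
      refine lp.norm_mono two_ne_zero fun k => ?_
      change ‖(x k : ℂ) * u k‖ ≤ ‖(‖x‖ : ℂ) * u k‖
      simp only [norm_mul, Complex.norm_real, norm_norm]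
      exact mul_le_mul_of_nonneg_right (x.norm_coe_le_norm k) (norm_nonneg _)
    rw [norm_smul, Complex.norm_real, norm_norm] at h
    exact h

theorem norm_diagOp_le (x : ℤ →ᵇ ℝ) : ‖diagOp x‖ ≤ ‖x‖ :=
  LinearMap.mkContinuous_norm_le _ (norm_nonneg _) _

/-- The space of pairs of bounded real sequences `(a, b)`. -/
abbrev Coeff : Type := (ℤ →ᵇ ℝ) × (ℤ →ᵇ ℝ)

/-- The tridiagonal operator with given coefficients, as a function. -/
def tridiagFun (e : Coeff) : H →L[ℂ] H :=
  diagOp e.1 ∘L (shiftOp 1).toContinuousLinearMap +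
    (shiftOp (-1)).toContinuousLinearMap ∘L diagOp e.1 + diagOp e.2

theorem tridiagFun_apply (e : Coeff) (u : H) (n : ℤ) :
    tridiagFun e u n = e.1 n * u (n + 1) + e.1 (n - 1) * u (n - 1) + e.2 n * u n := rfl

/-- The tridiagonal operator with given coefficients, as a real linear map. -/
def tridiag : Coeff →L[ℝ] (H →L[ℂ] H) :=
  LinearMap.mkContinuous
    { toFun := tridiagFun
      map_add' := fun d e => by
        ext u n
        change tridiagFun (d + e) u n = tridiagFun d u n + tridiagFun e u n
        simp only [tridiagFun_apply, Prod.fst_add, Prod.snd_add, coe_add, Pi.add_apply]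
        push_cast
        ring
      map_smul' := fun c e => by
        ext u n
        change tridiagFun (c • e) u n = c * tridiagFun e u n
        simp only [tridiagFun_apply, Prod.smul_fst, Prod.smul_snd, coe_smul, smul_eq_mul]
        push_cast
        ring } 3 fun e => by
    have h1 : ∀ n, ‖(shiftOp n).toContinuousLinearMap‖ ≤ 1 := fun n =>
      (shiftOp n).norm_toContinuousLinearMap_le
    have h2 := (norm_diagOp_le e.1).trans (norm_fst_le e)
    have h3 := (norm_diagOp_le e.2).trans (norm_snd_le e)
    have h4 : ‖diagOp e.1 ∘L (shiftOp 1).toContinuousLinearMap‖ ≤ ‖e‖ * 1 :=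
      (ContinuousLinearMap.opNorm_comp_le _ _).trans
        (mul_le_mul h2 (h1 1) (norm_nonneg _) (norm_nonneg _))
    have h5 : ‖(shiftOp (-1)).toContinuousLinearMap ∘L diagOp e.1‖ ≤ 1 * ‖e‖ :=
      (ContinuousLinearMap.opNorm_comp_le _ _).trans
        (mul_le_mul (h1 (-1)) h2 (norm_nonneg _) zero_le_one)
    change ‖tridiagFun e‖ ≤ _
    refine norm_add₃_le.trans ?_
    linarith

theorem tridiag_apply (e : Coeff) (u : H) (n : ℤ) :
    tridiag e u n = e.1 n * u (n + 1) + e.1 (n - 1) * u (n - 1) + e.2 n * u n := rfl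

theorem norm_tridiag_le (e : Coeff) : ‖tridiag e‖ ≤ 3 * ‖e‖ :=
  (tridiag.le_opNorm e).trans (mul_le_mul_of_nonneg_right
    (LinearMap.mkContinuous_norm_le _ (by norm_num) _) (norm_nonneg _))

theorem entry_tridiag (e : Coeff) (j k : ℤ) : entry (tridiag e) j k =
    if k = j + 1 then (e.1 j : ℂ) else if j = k + 1 then (e.1 k : ℂ) else
      if j = k then (e.2 j : ℂ) else 0 := by
  rw [entry_eq, tridiag_apply]
  simp only [delta_apply]
  split_ifs <;> first | omega | skip
  all_goals try simp
  all_goals subst_vars; simp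

theorem isSelfAdjoint_tridiag (e : Coeff) : IsSelfAdjoint (tridiag e) := by
  refine ext_entry fun j k => ?_
  rw [entry_star, entry_tridiag, entry_tridiag]
  split_ifs <;> first | omega | simp
  subst_vars; rfl

/-- The coefficients of an operator on and above the diagonal. -/
def coords : (H →L[ℂ] H) →L[ℝ] Coeff :=
  LinearMap.mkContinuous
    { toFun := fun X =>
        (ofNormedAddCommGroupDiscrete (fun n => (entry X n (n + 1)).re) ‖X‖
          fun n => (Complex.abs_re_le_norm _).trans (norm_entry_le _ _ _),
         ofNormedAddCommGroupDiscrete (fun n => (entry X n n).re) ‖X‖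
          fun n => (Complex.abs_re_le_norm _).trans (norm_entry_le _ _ _))
      map_add' := fun X Y => by
        ext n <;> simp [entry_add]
      map_smul' := fun c X => by
        ext n <;> simp [entry_real_smul] } 1 fun X => by
    rw [one_mul]
    refine norm_prod_le_iff.2 ⟨?_, ?_⟩ <;>
    exact (BoundedContinuousFunction.norm_le (norm_nonneg _)).2
      fun n => (Complex.abs_re_le_norm _).trans (norm_entry_le _ _ _)

theorem coords_fst_apply (X : H →L[ℂ] H) (n : ℤ) : (coords X).1 n = (entry X n (n + 1)).re := rfl

theorem coords_snd_apply (X : H →L[ℂ] H) (n : ℤ) : (coords X).2 n = (entry X n n).re := rfl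

theorem norm_coords_le (X : H →L[ℂ] H) : ‖coords X‖ ≤ ‖X‖ := by
  simpa using (coords.le_opNorm X).trans (mul_le_mul_of_nonneg_right
    (LinearMap.mkContinuous_norm_le _ zero_le_one _) (norm_nonneg _))

theorem coords_tridiag (e : Coeff) : coords (tridiag e) = e := by
  ext n
  · simp [coords_fst_apply, entry_tridiag]
  · simp [coords_snd_apply, entry_tridiag]

/-- With `norm_tridiag_le`, the operator norm of a tridiagonal operator is equivalent to the sup
norm of its coefficients, so the Lax equation may be solved in `Coeff`. -/
theorem norm_le_norm_tridiag (e : Coeff) : ‖e‖ ≤ ‖tridiag e‖ := by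
  conv_lhs => rw [← coords_tridiag e]
  exact norm_coords_le _

theorem isJacobi_tridiag {e : Coeff} (h : ∀ n, 0 < e.1 n) : IsJacobi (tridiag e) :=
  ⟨e.1, e.2, h, ⟨‖e‖, fun n => ⟨(e.1.norm_coe_le_norm n).trans (norm_fst_le e),
    (e.2.norm_coe_le_norm n).trans (norm_snd_le e)⟩⟩, fun u n => tridiag_apply e u n⟩

theorem tridiag_coords_of_isJacobi {J : H →L[ℂ] H} (h : IsJacobi J) :
    tridiag (coords J) = J ∧ ∀ n, 0 < (coords J).1 n := by
  obtain ⟨a, b, ha, ⟨C, hC⟩, hJ⟩ := h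
  let e : Coeff := (ofNormedAddCommGroupDiscrete a C fun n => (hC n).1,
    ofNormedAddCommGroupDiscrete b C fun n => (hC n).2)
  have he : J = tridiag e := by
    ext u n
    rw [hJ u n, tridiag_apply]
    rfl
  rw [he, coords_tridiag]
  exact ⟨rfl, ha⟩

theorem tridiag_coords (J : Jac) : tridiag (coords J.1) = J.1 :=
  (tridiag_coords_of_isJacobi J.2).1

theorem coeffA_pos (J : Jac) (n : ℤ) : 0 < coeffA J n :=
  (tridiag_coords_of_isJacobi J.2).2 n

end Toda
end

noncomputable section

/-! ### The functional calculus on a Hilbert space -/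

namespace Toda

section FunCalc

open Polynomial

variable {E : Type*} [NormedAddCommGroup E] [InnerProductSpace ℂ E] [CompleteSpace E]

theorem isSelfAdjoint_funCalc (f : ℝ → ℝ) (X : E →L[ℂ] E) : IsSelfAdjoint (funCalc f X) :=
  IsSelfAdjoint.cfc

theorem commute_funCalc (f : ℝ → ℝ) (X : E →L[ℂ] E) : Commute (funCalc f X) X :=
  (Commute.refl X).cfc_real f

theorem funCalc_const_mul {f : ℝ → ℝ} (hf : Continuous f) (t : ℝ) (X : E →L[ℂ] E) :
    funCalc (fun x => t * f x) X = t • funCalc f X :=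
  cfc_const_mul t f X hf.continuousOn

variable [Nontrivial E]

theorem norm_funCalc_le {f : ℝ → ℝ} {X : E →L[ℂ] E} {M : ℝ} (hM : 0 ≤ M)
    (h : ∀ x, |x| ≤ ‖X‖ → |f x| ≤ M) : ‖funCalc f X‖ ≤ M :=
  norm_cfc_le hM fun x hx => h x (by simpa using spectrum.norm_le_norm_of_mem hx)

/-- The functional calculus can be approximated by polynomials. -/
theorem exists_norm_funCalc_sub_aeval_le {f : ℝ → ℝ} (hf : Continuous f) (R : ℝ) {ε : ℝ}
    (hε : 0 < ε) : ∃ p : ℝ[X], ∀ X : E →L[ℂ] E, IsSelfAdjoint X → ‖X‖ ≤ R →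
      ‖funCalc f X - aeval X p‖ ≤ ε := by
  obtain ⟨p, hp⟩ := exists_polynomial_near_of_continuousOn (-R) R f hf.continuousOn ε hε
  refine ⟨p, fun X hX hR => ?_⟩
  rw [funCalc, ← cfc_polynomial p X hX,
    ← cfc_sub f p.eval X hf.continuousOn p.continuous.continuousOn]
  refine norm_cfc_le hε.le fun x hx => ?_
  rw [norm_sub_rev]
  have hx' : |x| ≤ R := by simpa using (spectrum.norm_le_norm_of_mem hx).trans hR
  exact (hp x (abs_le.1 hx')).le

theorem exists_norm_funCalc_sub_le {f : ℝ → ℝ} (hf : ContDiff ℝ 2 f) {R : ℝ} (hR : 0 ≤ R) :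
    ∃ C, 0 ≤ C ∧ ∀ X Y : E →L[ℂ] E, IsSelfAdjoint X → IsSelfAdjoint Y → ‖X‖ ≤ R → ‖Y‖ ≤ R →
      ‖funCalc f X - funCalc f Y‖ ≤ C * ‖X - Y‖ :=
  OperatorLipschitz.exists_norm_cfc_sub_le hf hR

end FunCalc

end Toda

/-! ### The Lax vector field in coordinates -/

namespace Toda

open BoundedContinuousFunction

instance instNontrivialH : Nontrivial H := ⟨delta 0, 0, fun h => by
  have := norm_delta 0
  rw [h, norm_zero] at this
  exact zero_ne_one this⟩

theorem tridiag_delta (e : Coeff) (k : ℤ) : tridiag e (delta k) =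
    (e.1 (k - 1) : ℂ) • delta (k - 1) + (e.1 k : ℂ) • delta (k + 1) + (e.2 k : ℂ) • delta k := by
  refine lp.ext (funext fun j => ?_)
  rw [← entry_eq, entry_tridiag]
  simp only [lp.coeFn_add, lp.coeFn_smul, Pi.add_apply, Pi.smul_apply, delta_apply, smul_eq_mul]
  split_ifs <;> first | omega | skip
  all_goals try simp
  all_goals subst_vars; simp

theorem entry_mul_tridiag (X : H →L[ℂ] H) (e : Coeff) (j k : ℤ) : entry (X * tridiag e) j k =
    e.1 (k - 1) * entry X j (k - 1) + e.1 k * entry X j (k + 1) + e.2 k * entry X j k := by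
  simp only [entry_eq]
  change X (tridiag e (delta k)) j = _
  rw [tridiag_delta, map_add, map_add, map_smul, map_smul, map_smul]
  rfl

theorem entry_tridiag_mul (X : H →L[ℂ] H) (e : Coeff) (j k : ℤ) : entry (tridiag e * X) j k =
    e.1 j * entry X (j + 1) k + e.1 (j - 1) * entry X (j - 1) k + e.2 j * entry X j k := by
  simp only [entry_eq]
  exact tridiag_apply e (X (delta k)) j

/-- The entries of the commutator of the antisymmetric part of a symmetric matrix `F` with a
tridiagonal matrix commuting with `F`. -/
theorem antisymm_commutator {F : ℤ → ℤ → ℂ} {a b : ℤ → ℂ} (hs : ∀ j k, F j k = F k j)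
    (hc : ∀ j k, a (k - 1) * F j (k - 1) + a k * F j (k + 1) + b k * F j k =
      a j * F (j + 1) k + a (j - 1) * F (j - 1) k + b j * F j k)
    {M : ℤ → ℤ → ℂ} (hM : ∀ j k, M j k = if j < k then F j k else if k < j then -F j k else 0)
    (j k : ℤ) :
    (a (k - 1) * M j (k - 1) + a k * M j (k + 1) + b k * M j k) -
      (a j * M (j + 1) k + a (j - 1) * M (j - 1) k + b j * M j k) =
    if k = j + 1 then a j * (F (j + 1) (j + 1) - F j j)
    else if j = k + 1 then a k * (F (k + 1) (k + 1) - F k k)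
    else if j = k then 2 * (a j * F j (j + 1) - a (j - 1) * F (j - 1) j) else 0 := by
  have up : ∀ {j k}, j < k → M j k = F j k := fun h => by rw [hM, if_pos h]
  have lo : ∀ {j k}, k < j → M j k = -F j k := fun h => by
    rw [hM, if_neg (not_lt.2 h.le), if_pos h]
  have di : ∀ j, M j j = 0 := fun j => by simp [hM]
  -- Strictly above the band every entry involved is `F`, and strictly below it `-F`, so commutation
  -- with `F` makes the result vanish.
  rcases lt_or_ge (j + 1) k with h1 | h1
  · rw [if_neg (by omega), if_neg (by omega), if_neg (by omega), up (by omega), up (by omega),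
      up (by omega), up (by omega), up (by omega), hc j k]
    ring
  rcases lt_or_ge (k + 1) j with h2 | h2
  · rw [if_neg (by omega), if_neg (by omega), if_neg (by omega), lo (by omega), lo (by omega),
      lo (by omega), lo (by omega), lo (by omega)]
    linear_combination -hc j k
  -- On the two off-diagonals the diagonal entries missing from `M` leave a difference of diagonal
  -- entries of `F`. On the diagonal the upper and lower terms add up by symmetry, whence the factor
  -- `2`.
  have h3 : k = j + 1 ∨ j = k + 1 ∨ j = k := by omega
  rcases h3 with rfl | rfl | rfl
  · have h := hc j (j + 1)
    rw [if_pos rfl]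
    rw [add_sub_cancel_right] at h ⊢
    rw [di, up (by omega), up (by omega), di, up (by omega)]
    linear_combination h
  · have h := hc (k + 1) k
    rw [if_neg (by omega), if_pos rfl]
    rw [add_sub_cancel_right] at h ⊢
    rw [lo (by omega), di, lo (by omega), lo (by omega), di]
    linear_combination -h
  · rw [if_neg (by omega), if_neg (by omega), if_pos rfl, lo (by omega), up (by omega), di,
      lo (by omega), up (by omega), hs j (j - 1), hs (j + 1) j]
    ring

/-- An operator whose matrix elements are real. -/
def IsRealOp (X : H →L[ℂ] H) : Prop := ∀ j k, (entry X j k).im = 0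

theorem IsRealOp.add {X Y : H →L[ℂ] H} (hX : IsRealOp X) (hY : IsRealOp Y) :
    IsRealOp (X + Y) := fun j k => by rw [entry_add, Complex.add_im, hX, hY, add_zero]

theorem IsRealOp.smul {X : H →L[ℂ] H} (hX : IsRealOp X) (c : ℝ) : IsRealOp (c • X) :=
  fun j k => by rw [entry_real_smul, Complex.im_ofReal_mul, hX, mul_zero]

theorem IsRealOp.mul_tridiag {X : H →L[ℂ] H} (hX : IsRealOp X) (e : Coeff) :
    IsRealOp (X * tridiag e) := fun j k => by
  rw [entry_mul_tridiag, Complex.add_im, Complex.add_im, Complex.im_ofReal_mul,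
    Complex.im_ofReal_mul, Complex.im_ofReal_mul, hX, hX, hX]
  simp

theorem isRealOp_one : IsRealOp 1 := fun j k => by
  rw [entry_eq, one_apply_eq_self, delta_apply]
  split_ifs <;> simp

theorem isRealOp_zero : IsRealOp 0 := fun j k => by simp [entry_eq]

theorem entry_zero (j k : ℤ) : entry 0 j k = 0 := by simp [entry_eq]

open Polynomial in
theorem isRealOp_aeval (e : Coeff) (p : ℝ[X]) : IsRealOp (aeval (tridiag e) p) := by
  have hpow : ∀ i : ℕ, IsRealOp (tridiag e ^ i) := by
    intro i
    induction i with
    | zero => rw [pow_zero]; exact isRealOp_one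
    | succ i ih => rw [pow_succ]; exact ih.mul_tridiag e
  rw [aeval_eq_sum_range]
  exact Finset.sum_induction _ IsRealOp (fun _ _ => IsRealOp.add) isRealOp_zero
    fun i _ => (hpow i).smul _

open Polynomial in
-- Each factor of a tridiagonal operator widens the band by one.
theorem entry_aeval_of_natDegree_lt (e : Coeff) (p : ℝ[X]) {j k : ℤ}
    (h : (p.natDegree : ℤ) < |j - k|) : entry (aeval (tridiag e) p) j k = 0 := by
  have hpow : ∀ i : ℕ, ∀ j k : ℤ, (i : ℤ) < |j - k| → entry (tridiag e ^ i) j k = 0 := by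
    intro i
    induction i with
    | zero =>
      intro j k hjk
      rw [pow_zero, entry_eq, one_apply_eq_self, delta_apply, if_neg]
      rintro rfl
      simp at hjk
    | succ i ih =>
      intro j k hjk
      push_cast at hjk
      rw [pow_succ, entry_mul_tridiag, ih, ih, ih]
      · simp
      all_goals rw [lt_abs] at hjk ⊢; omega
  rw [aeval_eq_sum_range]
  exact Finset.sum_induction _ (fun X => entry X j k = 0)
    (fun X Y hX hY => by rw [entry_add, hX, hY, add_zero]) (entry_zero j k) fun i hi => by
      rw [entry_real_smul, hpow, mul_zero]
      have := Finset.mem_range.1 hi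
      omega

/-- Polynomials in a real tridiagonal operator have real entries, and this passes to norm limits. -/
theorem isRealOp_funCalc {f : ℝ → ℝ} (hf : Continuous f) (e : Coeff) :
    IsRealOp (funCalc f (tridiag e)) := by
  intro j k
  refine abs_eq_zero.1 (le_antisymm (le_of_forall_pos_le_add fun ε hε => ?_) (abs_nonneg _))
  obtain ⟨p, hp⟩ := exists_norm_funCalc_sub_aeval_le (E := H) hf ‖tridiag e‖ hε
  replace hp := hp _ (isSelfAdjoint_tridiag e) le_rfl
  have h1 : (entry (funCalc f (tridiag e)) j k).im
      = (entry (funCalc f (tridiag e) - Polynomial.aeval (tridiag e) p) j k).im := by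
    rw [entry_sub, Complex.sub_im, isRealOp_aeval, sub_zero]
  rw [h1, zero_add]
  exact (Complex.abs_im_le_norm _).trans ((norm_entry_le _ _ _).trans hp)

theorem IsRealOp.entry_comm {X : H →L[ℂ] H} (hX : IsRealOp X) (hs : IsSelfAdjoint X) (j k : ℤ) :
    entry X j k = entry X k j := by
  conv_lhs => rw [← hs.star_eq, entry_star]
  exact Complex.conj_eq_iff_im.2 (hX k j)

theorem IsRealOp.ofReal_re {X : H →L[ℂ] H} (hX : IsRealOp X) (j k : ℤ) :
    ((entry X j k).re : ℂ) = entry X j k := Complex.ext rfl (hX j k).symm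

/-- Translation of a bounded sequence. -/
def translate (n : ℤ) : (ℤ →ᵇ ℝ) →L[ℝ] (ℤ →ᵇ ℝ) :=
  compContinuousCLM ℝ ℝ ⟨fun k => k + n, continuous_of_discreteTopology⟩

theorem norm_translate_le (n : ℤ) (x : ℤ →ᵇ ℝ) : ‖translate n x‖ ≤ ‖x‖ :=
  norm_compContinuous_le _ _

/-- The coefficients of the Lax vector field at `e`, for a symmetric matrix commuting with
`tridiag e` and having the coefficients `g`. -/
def laxBilin (e g : Coeff) : Coeff :=
  (e.1 * (translate 1 g.2 - g.2), (2 : ℝ) • (e.1 * g.1 - translate (-1) (e.1 * g.1)))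

theorem laxBilin_fst_apply (e g : Coeff) (n : ℤ) :
    (laxBilin e g).1 n = e.1 n * (g.2 (n + 1) - g.2 n) := rfl

theorem laxBilin_snd_apply (e g : Coeff) (n : ℤ) :
    (laxBilin e g).2 n = 2 * (e.1 n * g.1 n - e.1 (n - 1) * g.1 (n - 1)) := rfl

theorem laxBilin_sub_left (d e g : Coeff) :
    laxBilin (d - e) g = laxBilin d g - laxBilin e g := by
  ext n
  · simp only [laxBilin_fst_apply, Prod.fst_sub, coe_sub, Pi.sub_apply]; ring
  · simp only [laxBilin_snd_apply, Prod.fst_sub, Prod.snd_sub, coe_sub, Pi.sub_apply]; ring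

theorem laxBilin_sub_right (e g h : Coeff) :
    laxBilin e (g - h) = laxBilin e g - laxBilin e h := by
  ext n
  · simp only [laxBilin_fst_apply, Prod.fst_sub, Prod.snd_sub, coe_sub, Pi.sub_apply]; ring
  · simp only [laxBilin_snd_apply, Prod.fst_sub, Prod.snd_sub, coe_sub, Pi.sub_apply]; ring

theorem laxBilin_smul_right (e g : Coeff) (c : ℝ) :
    laxBilin e (c • g) = c • laxBilin e g := by
  ext n
  · simp only [laxBilin_fst_apply, Prod.smul_fst, Prod.smul_snd, coe_smul, smul_eq_mul]; ring
  · simp only [laxBilin_snd_apply, Prod.smul_fst, Prod.smul_snd, coe_smul, smul_eq_mul]; ring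

theorem norm_laxBilin_le (e g : Coeff) : ‖laxBilin e g‖ ≤ 4 * (‖e‖ * ‖g‖) := by
  have h1 := norm_fst_le e
  have h2 := norm_fst_le g
  have h3 := norm_snd_le g
  refine norm_prod_le_iff.2 ⟨?_, ?_⟩
  · have h4 : ‖translate 1 g.2 - g.2‖ ≤ 2 * ‖g‖ := by
      refine (norm_sub_le _ _).trans ?_
      linarith [norm_translate_le 1 g.2]
    calc ‖e.1 * (translate 1 g.2 - g.2)‖ ≤ ‖e‖ * (2 * ‖g‖) :=
          (norm_mul_le _ _).trans (mul_le_mul h1 h4 (norm_nonneg _) (norm_nonneg _))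
      _ ≤ 4 * (‖e‖ * ‖g‖) := by nlinarith [mul_nonneg (norm_nonneg e) (norm_nonneg g)]
  · have h4 : ‖e.1 * g.1‖ ≤ ‖e‖ * ‖g‖ :=
      (norm_mul_le _ _).trans (mul_le_mul h1 h2 (norm_nonneg _) (norm_nonneg _))
    have h5 := norm_sub_le (e.1 * g.1) (translate (-1) (e.1 * g.1))
    change ‖(2 : ℝ) • (e.1 * g.1 - translate (-1) (e.1 * g.1))‖ ≤ _
    rw [norm_smul, Real.norm_ofNat]
    linarith [norm_translate_le (-1) (e.1 * g.1)]

/-- The Lax vector field in coordinates. -/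
def laxField (f : ℝ → ℝ) (e : Coeff) : Coeff := laxBilin e (coords (funCalc f (tridiag e)))

/-- The entries of the commutator of the antisymmetric part of a real symmetric operator `F` with
a tridiagonal operator commuting with `F`. -/
theorem antiPart_commutator {F : H →L[ℂ] H} (hr : IsRealOp F) (hs : IsSelfAdjoint F) {e : Coeff}
    (hc : Commute F (tridiag e)) (j k : ℤ) :
    (e.1 (k - 1) * antiPart F j (k - 1) + e.1 k * antiPart F j (k + 1) + e.2 k * antiPart F j k) -
      (e.1 j * antiPart F (j + 1) k + e.1 (j - 1) * antiPart F (j - 1) k + e.2 j * antiPart F j k)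
      = entry (tridiag (laxBilin e (coords F))) j k := by
  have h := antisymm_commutator (F := entry F) (a := fun n => (e.1 n : ℂ))
    (b := fun n => (e.2 n : ℂ)) (hr.entry_comm hs)
    (fun j k => by rw [← entry_mul_tridiag, ← entry_tridiag_mul, hc.eq])
    (M := antiPart F) (fun _ _ => rfl) j k
  rw [h, entry_tridiag]
  simp only [laxBilin_fst_apply, laxBilin_snd_apply, coords_fst_apply, coords_snd_apply]
  push_cast
  simp only [hr.ofReal_re, sub_add_cancel]

theorem Icc_sub_one_add_one (k : ℤ) : Finset.Icc (k - 1) (k + 1) = {k - 1, k + 1, k} := by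
  ext l
  simp only [Finset.mem_Icc, Finset.mem_insert, Finset.mem_singleton]
  omega

theorem sum_Icc_sub_one_add_one (k : ℤ) (G : ℤ → ℂ) :
    ∑ l ∈ Finset.Icc (k - 1) (k + 1), G l = G (k - 1) + G (k + 1) + G k := by
  rw [Icc_sub_one_add_one, Finset.sum_insert (by simp; omega), Finset.sum_insert (by simp),
    Finset.sum_singleton]
  ring

/-- The truncation to `|j - k| ≤ 1` loses nothing, since the formal commutator is already
tridiagonal. -/
theorem laxEntry_eq {f : ℝ → ℝ} (hf : Continuous f) (J : Jac) (j k : ℤ) :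
    laxEntry f J j k = entry (tridiag (laxField f (coords J.1))) j k := by
  have hJ := tridiag_coords J
  set e := coords J.1
  rw [laxField, ← antiPart_commutator (isRealOp_funCalc hf e) (isSelfAdjoint_funCalc f _)
    (commute_funCalc f (tridiag e))]
  rw [laxEntry, ← hJ]
  split_ifs with h
  · rw [sum_Icc_sub_one_add_one, sum_Icc_sub_one_add_one]
    have h1 : ∀ l, entry (tridiag e) l (l + 1) = e.1 l := fun l => by
      rw [entry_tridiag, if_pos rfl]
    have h2 : ∀ l, entry (tridiag e) (l + 1) l = e.1 l := fun l => by
      rw [entry_tridiag, if_neg (by omega), if_pos rfl]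
    have h3 : ∀ l, entry (tridiag e) l l = e.2 l := fun l => by
      rw [entry_tridiag, if_neg (by omega), if_neg (by omega), if_pos rfl]
    have h4 := h1 (k - 1)
    have h5 := h2 (j - 1)
    rw [sub_add_cancel] at h4 h5
    rw [h1, h2, h3, h3, h4, h5]
    ring
  · rw [antiPart_commutator (isRealOp_funCalc hf e) (isSelfAdjoint_funCalc f _) (commute_funCalc f (tridiag e)),
      entry_tridiag]
    rw [abs_le] at h
    split_ifs <;> first | omega | rfl

end Toda
end

noncomputable section

/-! ### Global solutions of the Lax equation -/

namespace Toda

open BoundedContinuousFunction Set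
open scoped NNReal

/-! ### Commutators with skew-adjoint operators. -/

section Commutator

variable {E : Type*} [NormedAddCommGroup E] [InnerProductSpace ℂ E] [CompleteSpace E]

theorem funCalc_eval (p : Polynomial ℝ) {X : E →L[ℂ] E} (hX : IsSelfAdjoint X) :
    funCalc (fun x => p.eval x) X = Polynomial.aeval X p := cfc_polynomial p X hX

variable [Nontrivial E]

/-- By the C*-identity it suffices to bound `(1 - hP)* (1 - hP)`, whose terms linear in `h` cancel
for skew-adjoint `P`. -/
theorem norm_sq_one_sub_le {P : E →L[ℂ] E} (hP : star P = -P) (h : ℝ) :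
    ‖1 - h • P‖ * ‖1 - h • P‖ ≤ 1 + h ^ 2 * ‖P‖ ^ 2 := by
  have e : star (1 - h • P) * (1 - h • P) = 1 - (h ^ 2) • (P * P) := by
    rw [star_sub, star_one, star_smul, hP, star_trivial, smul_neg, sub_neg_eq_add, mul_sub,
      add_mul, add_mul, smul_mul_smul_comm, pow_two, one_mul, one_mul, mul_one]
    abel
  rw [← CStarRing.norm_star_mul_self, e]
  refine (norm_sub_le _ _).trans ?_
  rw [norm_one, norm_smul, Real.norm_of_nonneg (sq_nonneg h)]
  have h1 : ‖P * P‖ ≤ ‖P‖ ^ 2 := by rw [pow_two ‖P‖]; exact norm_mul_le P P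
  exact add_le_add le_rfl (mul_le_mul_of_nonneg_left h1 (sq_nonneg h))

/-- To first order, the commutator with a skew-adjoint operator does not change the norm. -/
theorem norm_add_smul_commutator_le {P : E →L[ℂ] E} (hP : star P = -P) (Y : E →L[ℂ] E) (h : ℝ) :
    ‖Y + h • (P * Y - Y * P)‖ ≤ ‖Y‖ + 2 * h ^ 2 * ‖P‖ ^ 2 * ‖Y‖ := by
  -- Up to order `h²`, the perturbation is the congruence `(1 + hP) Y (1 - hP)`.
  have e : Y + h • (P * Y - Y * P)
      = star (1 - h • P) * Y * (1 - h • P) + (h ^ 2) • (P * Y * P) := by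
    rw [star_sub, star_one, star_smul, hP, star_trivial, smul_neg, sub_neg_eq_add]
    simp only [mul_sub, add_mul, one_mul, mul_one, smul_mul_assoc, mul_smul_comm, smul_sub,
      smul_add, smul_smul, pow_two]
    abel
  have h1 : ‖star (1 - h • P) * Y * (1 - h • P)‖ ≤ (1 + h ^ 2 * ‖P‖ ^ 2) * ‖Y‖ := by
    calc _ ≤ ‖star (1 - h • P)‖ * ‖Y‖ * ‖1 - h • P‖ :=
          (norm_mul_le _ _).trans (mul_le_mul_of_nonneg_right (norm_mul_le _ _) (norm_nonneg _))
      _ = ‖1 - h • P‖ * ‖1 - h • P‖ * ‖Y‖ := by rw [norm_star]; ring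
      _ ≤ _ := mul_le_mul_of_nonneg_right (norm_sq_one_sub_le hP h) (norm_nonneg _)
  have h2 : ‖P * Y * P‖ ≤ ‖P‖ ^ 2 * ‖Y‖ := by
    calc _ ≤ ‖P‖ * ‖Y‖ * ‖P‖ :=
          (norm_mul_le _ _).trans (mul_le_mul_of_nonneg_right (norm_mul_le _ _) (norm_nonneg _))
      _ = ‖P‖ ^ 2 * ‖Y‖ := by ring
  rw [e]
  refine (norm_add_le _ _).trans ?_
  rw [norm_smul, Real.norm_of_nonneg (sq_nonneg h)]
  nlinarith [mul_le_mul_of_nonneg_left h2 (sq_nonneg h)]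

end Commutator

/-- The strictly upper triangular part of a banded operator with real entries is bounded. -/
theorem exists_upper_part {F : H →L[ℂ] H} (hr : IsRealOp F) {N : ℕ}
    (hb : ∀ j k, (N : ℤ) < |j - k| → entry F j k = 0) :
    ∃ Q : H →L[ℂ] H, ∀ j k, entry Q j k = if j < k then entry F j k else 0 := by
  -- Superdiagonals are added one at a time, each as a diagonal operator times a shift. The band
  -- hypothesis makes finitely many suffice.
  have key : ∀ M : ℕ, ∃ Q : H →L[ℂ] H, ∀ j k, entry Q j k =
      if j < k ∧ k ≤ j + M then entry F j k else 0 := by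
    intro M
    induction M with
    | zero =>
      refine ⟨0, fun j k => ?_⟩
      rw [if_neg (by push_cast; omega), entry_zero]
    | succ M ih =>
      obtain ⟨Q, hQ⟩ := ih
      let x : ℤ →ᵇ ℝ := ofNormedAddCommGroupDiscrete
        (fun n => (entry F n (n + (M + 1 : ℤ))).re) ‖F‖
        fun n => (Complex.abs_re_le_norm _).trans (norm_entry_le _ _ _)
      have hx : ∀ n, (x n : ℂ) = entry F n (n + (M + 1 : ℤ)) := fun n => hr.ofReal_re _ _
      refine ⟨Q + diagOp x ∘L (shiftOp (M + 1)).toContinuousLinearMap, fun j k => ?_⟩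
      have h1 : entry (diagOp x ∘L (shiftOp (M + 1)).toContinuousLinearMap) j k
          = x j * delta k (j + (M + 1)) := by
        rw [entry_eq]
        rfl
      rw [entry_add, hQ, h1, hx, delta_apply]
      push_cast
      by_cases h2 : j + (M + 1) = k
      · rw [if_neg (by omega), if_pos h2, if_pos (by omega), h2, zero_add, mul_one]
      · rw [if_neg h2, mul_zero, add_zero]
        refine if_congr ?_ rfl rfl
        omega
  obtain ⟨Q, hQ⟩ := key N
  refine ⟨Q, fun j k => ?_⟩
  rw [hQ]
  by_cases h1 : j < k
  · rw [if_pos h1]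
    by_cases h2 : k ≤ j + N
    · rw [if_pos ⟨h1, h2⟩]
    · rw [if_neg (fun h => h2 h.2), hb]
      rw [lt_abs]
      omega
  · rw [if_neg h1, if_neg (fun h => h1 h.1)]

/-- For a polynomial, the Lax vector field is a commutator with a skew-adjoint operator. -/
theorem exists_tridiag_laxField_eval (p : Polynomial ℝ) (e : Coeff) :
    ∃ P : H →L[ℂ] H, star P = -P ∧
      tridiag (laxField (fun x => p.eval x) e) = P * tridiag e - tridiag e * P := by
  have hpc : Continuous fun x => p.eval x := p.continuous
  have hr := isRealOp_funCalc hpc e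
  have hs := isSelfAdjoint_funCalc (fun x => p.eval x) (tridiag e)
  obtain ⟨Q, hQ⟩ := exists_upper_part hr (N := p.natDegree) fun j k h => by
    rw [funCalc_eval p (isSelfAdjoint_tridiag e)]
    exact entry_aeval_of_natDegree_lt e p h
  have hP : ∀ j k, entry (Q - star Q) j k
      = antiPart (funCalc (fun x => p.eval x) (tridiag e)) j k := by
    intro j k
    rw [entry_sub, entry_star, hQ, hQ, antiPart]
    rcases lt_trichotomy j k with h | h | h
    · rw [if_pos h, if_neg h.not_gt, if_pos h, star_zero, sub_zero]
    · subst h; simp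
    · rw [if_neg h.not_gt, if_pos h, if_neg h.not_gt, if_pos h, zero_sub, hr.entry_comm hs j k]
      congr 1
      exact Complex.conj_eq_iff_im.2 (hr k j)
  refine ⟨Q - star Q, by rw [star_sub, star_star, neg_sub], ext_entry fun j k => ?_⟩
  rw [laxField, ← antiPart_commutator hr hs (commute_funCalc _ _), entry_sub, entry_mul_tridiag,
    entry_tridiag_mul]
  simp only [hP]

theorem norm_tridiag_laxField_sub_le (f g : ℝ → ℝ) (e : Coeff) :
    ‖tridiag (laxField f e) - tridiag (laxField g e)‖
      ≤ 12 * ‖e‖ * ‖funCalc f (tridiag e) - funCalc g (tridiag e)‖ := by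
  rw [← map_sub, laxField, laxField, ← laxBilin_sub_right, ← map_sub]
  have h1 := norm_tridiag_le (laxBilin e (coords (funCalc f (tridiag e) - funCalc g (tridiag e))))
  have h2 := norm_laxBilin_le e (coords (funCalc f (tridiag e) - funCalc g (tridiag e)))
  have h3 := mul_le_mul_of_nonneg_left
    (norm_coords_le (funCalc f (tridiag e) - funCalc g (tridiag e))) (norm_nonneg e)
  linarith

/-- The Lax vector field is tangent to the level sets of the operator norm. -/
theorem exists_norm_tridiag_add_smul_laxField_le {f : ℝ → ℝ} (hf : Continuous f) (e : Coeff)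
    {r : ℝ} (hr : 0 < r) : ∃ δ, 0 < δ ∧ ∀ h : ℝ, |h| < δ →
      ‖tridiag e + h • tridiag (laxField f e)‖ ≤ ‖tridiag e‖ + r * |h| := by
  -- The budget `r` is halved between replacing `f` by a polynomial `p` and the second order error
  -- for `p`. The detour matters because the antisymmetric part of `f(J)` itself need not be
  -- bounded.
  obtain ⟨p, hp⟩ := exists_norm_funCalc_sub_aeval_le (E := H) hf ‖tridiag e‖
    (show 0 < r / (2 * (12 * ‖e‖ + 1)) by positivity)
  replace hp := hp _ (isSelfAdjoint_tridiag e) le_rfl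
  rw [← funCalc_eval p (isSelfAdjoint_tridiag e)] at hp
  have h1 : ‖tridiag (laxField f e) - tridiag (laxField (fun x => p.eval x) e)‖ ≤ r / 2 := by
    refine (norm_tridiag_laxField_sub_le _ _ e).trans ?_
    calc _ ≤ (12 * ‖e‖ + 1) * (r / (2 * (12 * ‖e‖ + 1))) :=
          mul_le_mul (by linarith) hp (norm_nonneg _) (by positivity)
      _ = r / 2 := by field_simp
  obtain ⟨P, hP, hPe⟩ := exists_tridiag_laxField_eval p e
  set K := ‖P‖ ^ 2 * ‖tridiag e‖ with hK
  have hK0 : 0 ≤ K := by positivity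
  refine ⟨r / (4 * K + 1), by positivity, fun h hh => ?_⟩
  have h2 : ‖tridiag e + h • tridiag (laxField (fun x => p.eval x) e)‖
      ≤ ‖tridiag e‖ + 2 * h ^ 2 * ‖P‖ ^ 2 * ‖tridiag e‖ := by
    rw [hPe]
    exact norm_add_smul_commutator_le hP (tridiag e) h
  have h3 : 2 * |h| * K ≤ r / 2 := by
    rw [lt_div_iff₀ (by positivity)] at hh
    nlinarith [abs_nonneg h]
  have h4 : tridiag e + h • tridiag (laxField f e)
      = (tridiag e + h • tridiag (laxField (fun x => p.eval x) e)) +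
        h • (tridiag (laxField f e) - tridiag (laxField (fun x => p.eval x) e)) := by
    rw [smul_sub]; abel
  rw [h4]
  refine (norm_add_le _ _).trans ?_
  rw [norm_smul, Real.norm_eq_abs]
  have h5 := mul_le_mul_of_nonneg_left h1 (abs_nonneg h)
  have h6 : 2 * h ^ 2 * ‖P‖ ^ 2 * ‖tridiag e‖ ≤ |h| * (r / 2) := by
    rw [← sq_abs h]
    calc _ = |h| * (2 * |h| * K) := by rw [hK]; ring
      _ ≤ _ := mul_le_mul_of_nonneg_left h3 (abs_nonneg h)
  linarith

/-- The norm need not be differentiable, so Gronwall is used in its Dini form: the right lower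
derivative of the norm is at most `0`. -/
theorem norm_tridiag_le_of_hasDerivAt_of_nonneg {f : ℝ → ℝ} (hf : Continuous f) {T : ℝ}
    {c : ℝ → ℝ} {α : ℝ → Coeff} (hα : ∀ t ∈ Ioo (-T) T, HasDerivAt α (c t • laxField f (α t)) t)
    {t : ℝ} (ht : t ∈ Ioo (-T) T) (h0 : 0 ≤ t) : ‖tridiag (α t)‖ ≤ ‖tridiag (α 0)‖ := by
  have hY : ∀ s ∈ Ioo (-T) T, HasDerivAt (fun s => tridiag (α s))
      (c s • tridiag (laxField f (α s))) s := fun s hs => by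
    have := tridiag.hasFDerivAt.comp_hasDerivAt s (hα s hs)
    rwa [map_smul] at this
  have hsub : Icc 0 t ⊆ Ioo (-T) T := fun s hs => ⟨by linarith [hs.1, ht.1, ht.2], hs.2.trans_lt ht.2⟩
  have := le_gronwallBound_of_liminf_deriv_right_le (f := fun s => ‖tridiag (α s)‖)
    (f' := fun _ => 0) (δ := ‖tridiag (α 0)‖) (K := 0) (ε := 0) (a := 0) (b := t)
    (fun s hs => (hY s (hsub hs)).continuousAt.norm.continuousWithinAt) ?_ le_rfl
    (fun s _ => by simp) t ⟨h0, le_rfl⟩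
  · rwa [gronwallBound_ε0, zero_mul, Real.exp_zero, mul_one] at this
  intro s hs r hr
  have hd := (hY s (hsub (Ico_subset_Icc_self hs))).isLittleO
  -- One third of `r` pays for the linearization of `α`, another for the tangency estimate; the rest
  -- makes the inequality strict.
  have hl := hd.bound (show 0 < r / 3 by positivity)
  obtain ⟨δ, hδ, hb⟩ := exists_norm_tridiag_add_smul_laxField_le hf (α s)
    (show 0 < r / (3 * (|c s| + 1)) by positivity)
  have hsm : ∀ᶠ z in 𝓝 s, |(z - s) * c s| < δ := by
    have : Tendsto (fun z => |(z - s) * c s|) (𝓝 s) (𝓝 |(s - s) * c s|) :=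
      Continuous.tendsto (by fun_prop) s
    rw [sub_self, zero_mul, abs_zero] at this
    exact this.eventually_lt_const hδ
  refine (Eventually.frequently ?_)
  filter_upwards [nhdsWithin_le_nhds hl, nhdsWithin_le_nhds hsm, self_mem_nhdsWithin] with z h1 h2 hz
  have hzs : 0 < z - s := sub_pos.2 hz
  have h3 := hb _ h2
  rw [inv_mul_lt_iff₀ hzs, sub_lt_iff_lt_add]
  have h4 : tridiag (α z) = (tridiag (α s) + ((z - s) * c s) • tridiag (laxField f (α s))) +
      (tridiag (α z) - tridiag (α s) - (z - s) • c s • tridiag (laxField f (α s))) := by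
    rw [mul_smul]; abel
  rw [h4]
  refine (norm_add_le _ _).trans_lt ?_
  rw [Real.norm_of_nonneg hzs.le] at h1
  have h5 : r / (3 * (|c s| + 1)) * |(z - s) * c s| ≤ r / 3 * (z - s) := by
    rw [abs_mul, abs_of_pos hzs]
    calc _ = r / 3 * (z - s) * (|c s| / (|c s| + 1)) := by field_simp
      _ ≤ r / 3 * (z - s) * 1 := by
        refine mul_le_mul_of_nonneg_left ?_ (by positivity)
        rw [div_le_one (by positivity)]
        linarith
      _ = _ := mul_one _
  nlinarith [mul_pos hr hzs]

/-- Along the Lax flow, even with a variable speed, the operator norm does not grow. -/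
theorem norm_tridiag_le_of_hasDerivAt {f : ℝ → ℝ} (hf : Continuous f) {T : ℝ}
    {c : ℝ → ℝ} {α : ℝ → Coeff} (hα : ∀ t ∈ Ioo (-T) T, HasDerivAt α (c t • laxField f (α t)) t)
    {t : ℝ} (ht : t ∈ Ioo (-T) T) : ‖tridiag (α t)‖ ≤ ‖tridiag (α 0)‖ := by
  rcases le_total 0 t with h | h
  · exact norm_tridiag_le_of_hasDerivAt_of_nonneg hf hα ht h
  · have hneg : ∀ s ∈ Ioo (-T) T, -s ∈ Ioo (-T) T := fun s hs =>
      ⟨by linarith [hs.2], by linarith [hs.1]⟩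
    have := norm_tridiag_le_of_hasDerivAt_of_nonneg hf (T := T) (c := fun s => -c (-s))
      (α := fun s => α (-s)) (fun s hs => by
        refine ((hα (-s) (hneg s hs)).scomp s (hasDerivAt_neg s)).congr_deriv ?_
        rw [neg_one_smul]
        exact (neg_smul (c (-s)) (laxField f (α (-s)))).symm)
      (hneg t ht) (by linarith)
    simpa using this

theorem exists_norm_funCalc_tridiag_le {f : ℝ → ℝ} (hf : Continuous f) (R : ℝ) :
    ∃ M, 0 ≤ M ∧ ∀ e : Coeff, ‖e‖ ≤ R → ‖funCalc f (tridiag e)‖ ≤ M := by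
  obtain ⟨M, hM⟩ := (isCompact_Icc (a := -(3 * R)) (b := 3 * R)).exists_bound_of_continuousOn
    hf.continuousOn
  refine ⟨max M 0, le_max_right _ _, fun e he => norm_funCalc_le (le_max_right _ _) fun x hx => ?_⟩
  refine (hM x (abs_le.1 ?_)).trans (le_max_left _ _)
  linarith [norm_tridiag_le e]

/-- The field is bilinear in the coefficients of `J` and those of `f(J)`, and `f` is operator
Lipschitz on bounded sets. -/
theorem exists_lipschitzOnWith_laxField {f : ℝ → ℝ} (hf : ContDiff ℝ 2 f) (R : ℝ) :
    ∃ K : ℝ≥0, LipschitzOnWith K (laxField f) (Metric.closedBall 0 R) := by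
  obtain ⟨M, hM0, hM⟩ := exists_norm_funCalc_tridiag_le hf.continuous R
  obtain ⟨C, hC0, hC⟩ := exists_norm_funCalc_sub_le (E := H) hf (R := max (3 * R) 0)
    (le_max_right _ _)
  refine ⟨(4 * M + 12 * |R| * C).toNNReal, LipschitzOnWith.of_dist_le_mul fun d hd e he => ?_⟩
  rw [mem_closedBall_zero_iff] at hd he
  rw [dist_eq_norm, dist_eq_norm, Real.coe_toNNReal _ (by positivity)]
  have hb : ∀ e : Coeff, ‖e‖ ≤ R → ‖tridiag e‖ ≤ max (3 * R) 0 := fun e he =>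
    (norm_tridiag_le e).trans ((by linarith : 3 * ‖e‖ ≤ 3 * R).trans (le_max_left _ _))
  have h1 := hC _ _ (isSelfAdjoint_tridiag d) (isSelfAdjoint_tridiag e) (hb d hd) (hb e he)
  have h2 : laxField f d - laxField f e = laxBilin (d - e) (coords (funCalc f (tridiag d))) +
      laxBilin e (coords (funCalc f (tridiag d) - funCalc f (tridiag e))) := by
    rw [laxField, laxField, laxBilin_sub_left, map_sub, laxBilin_sub_right]
    abel
  have h3 : ‖tridiag d - tridiag e‖ ≤ 3 * ‖d - e‖ := by
    rw [← map_sub]; exact norm_tridiag_le _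
  have h4 := norm_laxBilin_le (d - e) (coords (funCalc f (tridiag d)))
  have h5 := norm_laxBilin_le e (coords (funCalc f (tridiag d) - funCalc f (tridiag e)))
  have h6 := (norm_coords_le (funCalc f (tridiag d))).trans (hM d hd)
  have h7 : ‖coords (funCalc f (tridiag d) - funCalc f (tridiag e))‖ ≤ C * (3 * ‖d - e‖) :=
    (norm_coords_le _).trans (h1.trans (mul_le_mul_of_nonneg_left h3 hC0))
  have h8 : ‖d - e‖ * ‖coords (funCalc f (tridiag d))‖ ≤ ‖d - e‖ * M :=
    mul_le_mul_of_nonneg_left h6 (norm_nonneg _)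
  have h9 : ‖e‖ * ‖coords (funCalc f (tridiag d) - funCalc f (tridiag e))‖
      ≤ |R| * (C * (3 * ‖d - e‖)) :=
    mul_le_mul (he.trans (le_abs_self R)) h7 (norm_nonneg _) (abs_nonneg _)
  rw [h2]
  refine (norm_add_le _ _).trans ?_
  linarith

/-- The bound on the norm holds for any variable speed `c`, which is the form of a priori bound that
global existence asks for. -/
theorem exists_hasDerivAt_laxField {f : ℝ → ℝ} (hf : ContDiff ℝ 2 f) (e₀ : Coeff) :
    ∃ α : ℝ → Coeff, α 0 = e₀ ∧ ∀ t, HasDerivAt α (laxField f (α t)) t := by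
  refine GlobalODE.exists_hasDerivAt (v := fun _ => laxField f) (fun x => continuous_const)
    (fun R => ?_) e₀ fun T hT => ⟨‖tridiag e₀‖, norm_nonneg _, fun c α _ h0 hα t ht => ?_⟩
  · obtain ⟨K, hK⟩ := exists_lipschitzOnWith_laxField hf R
    exact ⟨K, fun _ _ => hK⟩
  · rw [← h0]
    exact (norm_le_norm_tridiag _).trans (norm_tridiag_le_of_hasDerivAt hf.continuous hα ht)

theorem eq_of_hasDerivAt_laxField {f : ℝ → ℝ} (hf : ContDiff ℝ 2 f) {α β : ℝ → Coeff}
    (h0 : α 0 = β 0) (hα : ∀ t, HasDerivAt α (laxField f (α t)) t)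
    (hβ : ∀ t, HasDerivAt β (laxField f (β t)) t) : α = β := by
  refine GlobalODE.eq_of_hasDerivAt (v := fun _ => laxField f) (fun R => ?_) h0 hα hβ
  obtain ⟨K, hK⟩ := exists_lipschitzOnWith_laxField hf R
  exact ⟨K, fun _ _ => hK⟩

/-- The off-diagonal coefficients stay positive along the Lax flow. -/
theorem fst_pos_of_hasDerivAt {f : ℝ → ℝ} (hf : Continuous f) {α : ℝ → Coeff}
    (hα : ∀ t, HasDerivAt α (laxField f (α t)) t) (h0 : ∀ n, 0 < (α 0).1 n) (t : ℝ) (n : ℤ) :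
    0 < (α t).1 n := by
  have hbd : ∀ t, ‖α t‖ ≤ ‖tridiag (α 0)‖ := fun t =>
    (norm_le_norm_tridiag _).trans (norm_tridiag_le_of_hasDerivAt (T := |t| + 1) (c := fun _ => 1)
      hf (fun s _ => by simpa using hα s) (abs_lt.1 (lt_add_one _)))
  obtain ⟨M, hM0, hM⟩ := exists_norm_funCalc_tridiag_le hf ‖tridiag (α 0)‖
  let ev : Coeff →L[ℝ] ℝ := (evalCLM ℝ n).comp (ContinuousLinearMap.fst ℝ _ _)
  have hd : ∀ t, HasDerivAt (fun s => (α s).1 n) ((laxField f (α t)).1 n) t := fun t =>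
    ev.hasFDerivAt.comp_hasDerivAt t (hα t)
  have hle : ∀ t, ‖(laxField f (α t)).1 n‖ ≤ 2 * M * ‖(α t).1 n‖ := by
    intro t
    have h1 := (norm_coords_le _).trans (hM _ (hbd t))
    have h2 := (((coords (funCalc f (tridiag (α t)))).2.norm_coe_le_norm (n + 1)).trans
      (norm_snd_le _)).trans h1
    have h3 := (((coords (funCalc f (tridiag (α t)))).2.norm_coe_le_norm n).trans
      (norm_snd_le _)).trans h1
    rw [laxField, laxBilin_fst_apply, norm_mul, mul_comm]
    refine mul_le_mul_of_nonneg_right ((norm_sub_le _ _).trans ?_) (norm_nonneg _)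
    linarith
  -- Since `|a_n'| ≤ 2M |a_n|`, a zero at time `t` would propagate back to time `0`.
  have hne : ∀ t, (α t).1 n ≠ 0 := by
    intro t ht
    have h1 := GlobalODE.norm_le_of_norm_deriv_le (T := |t| + 1) (M := 2 * M)
      (α := fun s => (α (s + t)).1 n) (α' := fun s => (laxField f (α (s + t))).1 n)
      (fun s _ => (hd (s + t)).comp_add_const s t) (fun s _ => hle (s + t))
      (t := -t) (abs_lt.1 (by rw [abs_neg]; exact lt_add_one _))
    rw [zero_add, ht, norm_zero, zero_mul, neg_add_cancel, norm_le_zero_iff] at h1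
    exact (h0 n).ne' h1
  have hc : Continuous fun s => (α s).1 n :=
    continuous_iff_continuousAt.2 fun t => (hd t).continuousAt
  by_contra hneg
  have hmem : (0 : ℝ) ∈ Set.range fun s => (α s).1 n :=
    mem_range_of_exists_le_of_exists_ge hc ⟨t, not_lt.1 hneg⟩ ⟨0, (h0 n).le⟩
  obtain ⟨s, hs⟩ := hmem
  exact hne s hs

end Toda
end

noncomputable section

/-! ### The Toda flow -/

namespace Toda

open BoundedContinuousFunction Set

theorem isLaxSolution_iff {f : ℝ → ℝ} (hf : Continuous f) {φ : ℝ → Jac} :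
    IsLaxSolution f φ ↔
      ∀ t, HasDerivAt (fun s => coords (φ s).1) (laxField f (coords (φ t).1)) t := by
  refine forall_congr' fun t => ⟨?_, fun h => ⟨tridiag (laxField f (coords (φ t).1)), ?_, ?_⟩⟩
  · rintro ⟨D, hD, he⟩
    have hDe : D = tridiag (laxField f (coords (φ t).1)) :=
      ext_entry fun j k => (he j k).trans (laxEntry_eq hf _ _ _)
    have := coords.hasFDerivAt.comp_hasDerivAt t hD
    rwa [hDe, coords_tridiag] at this
  · have := tridiag.hasFDerivAt.comp_hasDerivAt t h
    refine this.congr_of_eventuallyEq (Eventually.of_forall fun s => ?_)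
    exact (tridiag_coords (φ s)).symm
  · exact fun j k => (laxEntry_eq hf _ _ _).symm

theorem coords_injective : Function.Injective fun J : Jac => coords J.1 := fun J K h =>
  Subtype.ext (by
    rw [← tridiag_coords J, ← tridiag_coords K]
    exact congrArg tridiag h)

theorem exists_isLaxSolution {f : ℝ → ℝ} (hf : ContDiff ℝ 2 f) (J : Jac) :
    ∃ φ : ℝ → Jac, IsLaxSolution f φ ∧ φ 0 = J := by
  obtain ⟨α, h0, hα⟩ := exists_hasDerivAt_laxField hf (coords J.1)
  have hpos : ∀ t n, 0 < (α t).1 n := fst_pos_of_hasDerivAt hf.continuous hα (by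
    rw [h0]; exact coeffA_pos J)
  refine ⟨fun t => ⟨tridiag (α t), isJacobi_tridiag (hpos t)⟩, ?_, Subtype.ext ?_⟩
  · rw [isLaxSolution_iff hf.continuous]
    simpa only [coords_tridiag] using hα
  · change tridiag (α 0) = J.1
    rw [h0, tridiag_coords]

theorem IsLaxSolution.unique {f : ℝ → ℝ} (hf : ContDiff ℝ 2 f) {φ ψ : ℝ → Jac}
    (hφ : IsLaxSolution f φ) (hψ : IsLaxSolution f ψ) (h0 : φ 0 = ψ 0) : φ = ψ := by
  rw [isLaxSolution_iff hf.continuous] at hφ hψ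
  have := eq_of_hasDerivAt_laxField hf (by rw [h0]) hφ hψ
  exact funext fun t => coords_injective (congrFun this t)

theorem laxField_const_mul {f : ℝ → ℝ} (hf : Continuous f) (t : ℝ) (e : Coeff) :
    laxField (fun x => t * f x) e = t • laxField f e := by
  rw [laxField, funCalc_const_mul hf, map_smul, laxBilin_smul_right, laxField]

theorem IsLaxSolution.comp_mul {f : ℝ → ℝ} (hf : Continuous f) {φ : ℝ → Jac}
    (hφ : IsLaxSolution f φ) (t : ℝ) :
    IsLaxSolution (fun x => t * f x) (fun s => φ (t * s)) := by
  rw [isLaxSolution_iff hf] at hφ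
  rw [isLaxSolution_iff (hf.const_mul t)]
  intro s
  rw [laxField_const_mul hf]
  exact (hφ (t * s)).scomp s (by simpa using (hasDerivAt_id s).const_mul t)

theorem IsLaxSolution.comp_add {f : ℝ → ℝ} {φ : ℝ → Jac} (hφ : IsLaxSolution f φ) (t : ℝ) :
    IsLaxSolution f (fun s => φ (s + t)) := fun s => by
  obtain ⟨D, hD, he⟩ := hφ (s + t)
  exact ⟨D, hD.comp_add_const s t, he⟩

/-- The flow is defined as the time one map of `t f`; `s ↦ φ(ts)` is the solution for `t f`, and
uniqueness identifies it with the chosen one. -/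
theorem IsLaxSolution.flow_eq {f : ℝ → ℝ} (hf : ContDiff ℝ 2 f) {φ : ℝ → Jac}
    (hφ : IsLaxSolution f φ) (t : ℝ) : flow f t (φ 0) = φ t := by
  have h1 := hφ.comp_mul hf.continuous t
  have hex : ∃ ψ : ℝ → Jac, IsLaxSolution (fun x => t * f x) ψ ∧ ψ 0 = φ 0 :=
    ⟨fun s => φ (t * s), h1, congrArg φ (mul_zero t)⟩
  rw [flow, todaMap, dif_pos hex]
  have h2 := hex.choose_spec
  have h3 := IsLaxSolution.unique (contDiff_const.mul hf) h2.1 h1 (by rw [h2.2]; exact congrArg φ (mul_zero t).symm)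
  rw [h3]
  exact congrArg φ (mul_one t)

theorem isLaxSolution_flow {f : ℝ → ℝ} (hf : ContDiff ℝ 2 f) (J : Jac) :
    IsLaxSolution f (fun t => flow f t J) := by
  obtain ⟨φ, hφ, rfl⟩ := exists_isLaxSolution hf J
  have : (fun t => flow f t (φ 0)) = φ := funext fun t => hφ.flow_eq hf t
  rwa [this]

theorem flow_zero {f : ℝ → ℝ} (hf : ContDiff ℝ 2 f) (J : Jac) : flow f 0 J = J := by
  obtain ⟨φ, hφ, rfl⟩ := exists_isLaxSolution hf J
  exact hφ.flow_eq hf 0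

theorem flow_add {f : ℝ → ℝ} (hf : ContDiff ℝ 2 f) (s t : ℝ) (J : Jac) :
    flow f (s + t) J = flow f s (flow f t J) := by
  have h := ((isLaxSolution_flow hf J).comp_add t).flow_eq hf s
  simp only [zero_add] at h
  exact h.symm

theorem continuous_flow {f : ℝ → ℝ} (hf : ContDiff ℝ 2 f) (J : Jac) :
    Continuous fun t => flow f t J := by
  refine Continuous.subtype_mk (f := fun t => (flow f t J).1) ?_ _
  exact continuous_iff_continuousAt.2 fun t =>
    let ⟨_, hD, _⟩ := isLaxSolution_flow hf J t
    hD.continuousAt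

/-! ### Equivariance under conjugation and shifts. -/

section Conjugation

variable {E : Type*} [NormedAddCommGroup E] [InnerProductSpace ℂ E]

theorem aeval_conjugate {U V : E →L[ℂ] E} (hUV : U * V = 1) (hVU : V * U = 1) (X : E →L[ℂ] E)
    (p : Polynomial ℝ) : Polynomial.aeval (U * X * V) p = U * Polynomial.aeval X p * V := by
  have hpow : ∀ i : ℕ, (U * X * V) ^ i = U * X ^ i * V := by
    intro i
    induction i with
    | zero => simp [hUV]
    | succ i ih =>
      rw [pow_succ, ih, pow_succ]
      calc U * X ^ i * V * (U * X * V) = U * X ^ i * (V * U) * X * V := by noncomm_ring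
        _ = U * (X ^ i * X) * V := by rw [hVU]; noncomm_ring
  rw [Polynomial.aeval_eq_sum_range, Polynomial.aeval_eq_sum_range, Finset.mul_sum, Finset.sum_mul]
  refine Finset.sum_congr rfl fun i _ => ?_
  rw [hpow, mul_smul_comm, smul_mul_assoc]

variable [CompleteSpace E] [Nontrivial E]

/-- Clear for polynomials, hence for `f` by approximation with one polynomial on a ball containing
both operators. -/
theorem funCalc_conjugate {f : ℝ → ℝ} (hf : Continuous f) {U V : E →L[ℂ] E} (hUV : U * V = 1)
    (hVU : V * U = 1) {X : E →L[ℂ] E} (hX : IsSelfAdjoint X) (hX' : IsSelfAdjoint (U * X * V)) :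
    funCalc f (U * X * V) = U * funCalc f X * V := by
  refine eq_of_sub_eq_zero (norm_le_zero_iff.1 (le_of_forall_pos_le_add fun ε hε => ?_))
  have hc : 0 < 1 + ‖U‖ * ‖V‖ := by positivity
  obtain ⟨p, hp⟩ := exists_norm_funCalc_sub_aeval_le (E := E) hf (max ‖X‖ ‖U * X * V‖)
    (div_pos hε hc)
  have h1 := hp _ hX (le_max_left _ _)
  have h2 := hp _ hX' (le_max_right _ _)
  rw [aeval_conjugate hUV hVU] at h2
  have e : funCalc f (U * X * V) - U * funCalc f X * V =
      (funCalc f (U * X * V) - U * Polynomial.aeval X p * V) -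
        U * (funCalc f X - Polynomial.aeval X p) * V := by noncomm_ring
  rw [e, zero_add]
  refine (norm_sub_le _ _).trans ?_
  have h3 : ‖U * (funCalc f X - Polynomial.aeval X p) * V‖
      ≤ ‖U‖ * (ε / (1 + ‖U‖ * ‖V‖)) * ‖V‖ :=
    (norm_mul_le _ _).trans (mul_le_mul_of_nonneg_right ((norm_mul_le _ _).trans
      (mul_le_mul_of_nonneg_left h1 (norm_nonneg _))) (norm_nonneg _))
  calc _ ≤ ε / (1 + ‖U‖ * ‖V‖) + ‖U‖ * (ε / (1 + ‖U‖ * ‖V‖)) * ‖V‖ := add_le_add h2 h3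
    _ = ε := by field_simp

end Conjugation

/-- The shift on the matrix side. -/
def shiftConj (n : ℤ) (X : H →L[ℂ] H) : H →L[ℂ] H :=
  (shiftOp n).toContinuousLinearMap * X * (shiftOp (-n)).toContinuousLinearMap

theorem shift_val (n : ℤ) (J : Jac) : (shift n J).1 = shiftConj n J.1 := rfl

theorem shiftOp_neg_delta (n k : ℤ) : shiftOp (-n) (delta k) = delta (k + n) := by
  refine lp.ext (funext fun j => ?_)
  rw [shiftOp_apply, delta_apply, delta_apply]
  refine if_congr ?_ rfl rfl
  omega

theorem entry_shiftConj (n : ℤ) (X : H →L[ℂ] H) (j k : ℤ) :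
    entry (shiftConj n X) j k = entry X (j + n) (k + n) := by
  rw [entry_eq, entry_eq, ← shiftOp_neg_delta]
  rfl

theorem shiftOp_mul_shiftOp_neg (n : ℤ) :
    (shiftOp n).toContinuousLinearMap * (shiftOp (-n)).toContinuousLinearMap = 1 := by
  ext u k
  change u (k + n + -n) = u k
  rw [add_neg_cancel_right]

theorem funCalc_shiftConj {f : ℝ → ℝ} (hf : Continuous f) (n : ℤ) {X : H →L[ℂ] H}
    (hX : IsSelfAdjoint X) : funCalc f (shiftConj n X) = shiftConj n (funCalc f X) := by
  have h := shiftOp_mul_shiftOp_neg (-n)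
  rw [neg_neg] at h
  refine funCalc_conjugate hf (shiftOp_mul_shiftOp_neg n) h hX ?_
  refine ext_entry fun j k => ?_
  change entry (star (shiftConj n X)) j k = entry (shiftConj n X) j k
  rw [entry_star, entry_shiftConj, entry_shiftConj, ← entry_star, hX.star_eq]

/-- Translation of both coefficient sequences. -/
def translateCoeff (n : ℤ) : Coeff →L[ℝ] Coeff := (translate n).prodMap (translate n)

theorem coords_shiftConj (n : ℤ) (X : H →L[ℂ] H) :
    coords (shiftConj n X) = translateCoeff n (coords X) := by
  ext k
  · change (entry (shiftConj n X) k (k + 1)).re = (entry X (k + n) (k + n + 1)).re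
    rw [entry_shiftConj, add_right_comm]
  · change (entry (shiftConj n X) k k).re = (entry X (k + n) (k + n)).re
    rw [entry_shiftConj]

theorem tridiag_translateCoeff (n : ℤ) (e : Coeff) :
    tridiag (translateCoeff n e) = shiftConj n (tridiag e) := by
  refine ext_entry fun j k => ?_
  rw [entry_shiftConj, entry_tridiag, entry_tridiag]
  refine if_congr (by omega) rfl (if_congr (by omega) rfl (if_congr (by omega) rfl rfl))

theorem laxBilin_translateCoeff (n : ℤ) (e g : Coeff) :
    laxBilin (translateCoeff n e) (translateCoeff n g) = translateCoeff n (laxBilin e g) := by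
  ext k
  · change e.1 (k + n) * (g.2 (k + 1 + n) - g.2 (k + n)) =
      e.1 (k + n) * (g.2 (k + n + 1) - g.2 (k + n))
    rw [add_right_comm]
  · change 2 * (e.1 (k + n) * g.1 (k + n) - e.1 (k - 1 + n) * g.1 (k - 1 + n)) =
      2 * (e.1 (k + n) * g.1 (k + n) - e.1 (k + n - 1) * g.1 (k + n - 1))
    rw [sub_add_eq_add_sub]

theorem laxField_translateCoeff {f : ℝ → ℝ} (hf : Continuous f) (n : ℤ) (e : Coeff) :
    laxField f (translateCoeff n e) = translateCoeff n (laxField f e) := by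
  rw [laxField, tridiag_translateCoeff, funCalc_shiftConj hf n (isSelfAdjoint_tridiag e),
    coords_shiftConj, laxBilin_translateCoeff, laxField]

/-- The Lax field commutes with translations, so the shifted orbit solves the same equation, and
uniqueness applies. -/
theorem flow_shift {f : ℝ → ℝ} (hf : ContDiff ℝ 2 f) (t : ℝ) (n : ℤ) (J : Jac) :
    flow f t (shift n J) = shift n (flow f t J) := by
  have h1 : IsLaxSolution f (fun t => shift n (flow f t J)) := by
    have h := (isLaxSolution_iff hf.continuous).1 (isLaxSolution_flow hf J)
    rw [isLaxSolution_iff hf.continuous]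
    intro s
    simp only [shift_val, coords_shiftConj, laxField_translateCoeff hf.continuous]
    exact (translateCoeff n).hasFDerivAt.comp_hasDerivAt s (h s)
  have h2 := h1.flow_eq hf t
  simpa only [flow_zero hf] using h2

theorem shift_zero (J : Jac) : shift 0 J = J := by
  refine Subtype.ext (ext_entry fun j k => ?_)
  rw [shift_val, entry_shiftConj, add_zero, add_zero]

theorem shift_add (m n : ℤ) (J : Jac) : shift (m + n) J = shift m (shift n J) := by
  refine Subtype.ext (ext_entry fun j k => ?_)
  rw [shift_val, shift_val, shift_val, entry_shiftConj, entry_shiftConj, entry_shiftConj,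
    add_assoc, add_assoc]

end Toda
end

noncomputable section

/-! ### Linear matrix equations depending holomorphically on a parameter -/

namespace LinearODE

open Set Metric
open scoped NNReal

section General

variable {S : Type*} [NormedRing S]

/-- The product of two by two arrays. -/
def arrayMul (b Y : Fin 2 → Fin 2 → S) : Fin 2 → Fin 2 → S := fun i j => ∑ k, b i k * Y k j

theorem norm_arrayMul_le (b Y : Fin 2 → Fin 2 → S) : ‖arrayMul b Y‖ ≤ 2 * ‖b‖ * ‖Y‖ := by
  have hent : ∀ (Z : Fin 2 → Fin 2 → S) i j, ‖Z i j‖ ≤ ‖Z‖ := fun Z i j =>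
    (norm_le_pi_norm (Z i) j).trans (norm_le_pi_norm Z i)
  refine (pi_norm_le_iff_of_nonneg (by positivity)).2 fun i =>
    (pi_norm_le_iff_of_nonneg (by positivity)).2 fun j => ?_
  rw [arrayMul, Fin.sum_univ_two]
  have h : ∀ k, ‖b i k * Y k j‖ ≤ ‖b‖ * ‖Y‖ := fun k =>
    (norm_mul_le _ _).trans (mul_le_mul (hent b i k) (hent Y k j) (norm_nonneg _) (norm_nonneg _))
  refine (norm_add_le _ _).trans ?_
  linarith [h 0, h 1]

theorem arrayMul_sub (b Y Z : Fin 2 → Fin 2 → S) :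
    arrayMul b (Y - Z) = arrayMul b Y - arrayMul b Z := by
  ext i j
  simp [arrayMul, mul_sub]

theorem exists_lipschitzOnWith_arrayMul {b : ℝ → Fin 2 → Fin 2 → S} (hb : Continuous b) (R : ℝ) :
    ∃ K : ℝ≥0, ∀ t ∈ Icc (-R) R,
      LipschitzOnWith K (arrayMul (b t)) (closedBall (0 : Fin 2 → Fin 2 → S) R) := by
  obtain ⟨M, hM⟩ := (isCompact_Icc (a := -R) (b := R)).exists_bound_of_continuousOn hb.continuousOn
  refine ⟨(2 * max M 0).toNNReal, fun t ht => LipschitzOnWith.of_dist_le_mul fun Y _ Z _ => ?_⟩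
  rw [dist_eq_norm, dist_eq_norm, ← arrayMul_sub, Real.coe_toNNReal _ (by positivity)]
  refine (norm_arrayMul_le _ _).trans (mul_le_mul_of_nonneg_right ?_ (norm_nonneg _))
  linarith [hM t ht, le_max_left M 0]

variable [NormedSpace ℝ S]

theorem eq_of_hasDerivAt {b : ℝ → Fin 2 → Fin 2 → S} (hb : Continuous b)
    {Y Z : ℝ → Fin 2 → Fin 2 → S} (h0 : Y 0 = Z 0)
    (hY : ∀ t, HasDerivAt Y (arrayMul (b t) (Y t)) t)
    (hZ : ∀ t, HasDerivAt Z (arrayMul (b t) (Z t)) t) : Y = Z :=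
  GlobalODE.eq_of_hasDerivAt (v := fun t => arrayMul (b t))
    (exists_lipschitzOnWith_arrayMul hb) h0 hY hZ

/-- The entries are allowed in any complete normed ring over `ℝ` so that the disk algebra can be
used, which encodes holomorphy in `z`. -/
theorem exists_hasDerivAt [CompleteSpace S] {b : ℝ → Fin 2 → Fin 2 → S} (hb : Continuous b)
    (Y₀ : Fin 2 → Fin 2 → S) :
    ∃ Y : ℝ → Fin 2 → Fin 2 → S, Y 0 = Y₀ ∧ ∀ t, HasDerivAt Y (arrayMul (b t) (Y t)) t := by
  refine GlobalODE.exists_hasDerivAt (v := fun t => arrayMul (b t)) (fun x => ?_)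
    (exists_lipschitzOnWith_arrayMul hb) Y₀ fun T hT => ?_
  · refine continuous_pi fun i => continuous_pi fun j => continuous_finsetSum _ fun k _ => ?_
    exact ((continuous_apply k).comp ((continuous_apply i).comp hb)).mul continuous_const
  · obtain ⟨M, hM⟩ :=
      (isCompact_Icc (a := -T) (b := T)).exists_bound_of_continuousOn hb.continuousOn
    have hM0 : 0 ≤ M := (norm_nonneg _).trans (hM 0 ⟨by linarith, hT.le⟩)
    refine ⟨‖Y₀‖ * Real.exp (2 * M * T), by positivity, fun c α hc h0 hα t ht => ?_⟩
    have h1 := GlobalODE.norm_le_of_norm_deriv_le (M := 2 * M) hα (fun s hs => ?_) ht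
    · rw [h0] at h1
      refine h1.trans (mul_le_mul_of_nonneg_left (Real.exp_le_exp.2 ?_) (norm_nonneg _))
      exact mul_le_mul_of_nonneg_left (abs_lt.2 ht).le (by positivity)
    · have h2 := norm_arrayMul_le (b s) (α s)
      have h3 := mul_le_mul_of_nonneg_right (hM s (Ioo_subset_Icc_self hs)) (norm_nonneg (α s))
      rw [norm_smul, Real.norm_of_nonneg (hc s).1]
      calc c s * ‖arrayMul (b s) (α s)‖ ≤ 1 * ‖arrayMul (b s) (α s)‖ :=
            mul_le_mul_of_nonneg_right (hc s).2 (norm_nonneg _)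
        _ ≤ 2 * M * ‖α s‖ := by linarith

end General

/-! ### The disk algebra and holomorphic dependence on the parameter. -/

open Classical in
/-- Extension by zero of a function on a closed disk. -/
def extend (R : ℝ) (g : C(closedBall (0 : ℂ) R, ℂ)) (z : ℂ) : ℂ :=
  if h : z ∈ closedBall (0 : ℂ) R then g ⟨z, h⟩ else 0

theorem extend_of_mem {R : ℝ} (g : C(closedBall (0 : ℂ) R, ℂ)) {z : ℂ} (h : z ∈ ball (0 : ℂ) R) :
    extend R g z = g ⟨z, ball_subset_closedBall h⟩ := dif_pos _

/-- The algebra of continuous functions on a closed disk that are holomorphic in the interior. -/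
def diskAlgebra (R : ℝ) : Subalgebra ℂ C(closedBall (0 : ℂ) R, ℂ) where
  carrier := {g | DifferentiableOn ℂ (extend R g) (ball 0 R)}
  mul_mem' {g h} hg hh := (hg.mul hh).congr fun z hz => by
    simp only [Pi.mul_apply, extend_of_mem _ hz, ContinuousMap.mul_apply]
  add_mem' {g h} hg hh := (hg.add hh).congr fun z hz => by
    simp only [Pi.add_apply, extend_of_mem _ hz, ContinuousMap.add_apply]
  algebraMap_mem' c := (differentiableOn_const c).congr fun z hz => by
    rw [extend_of_mem _ hz]
    simp

/-- Weierstrass: uniform limits of holomorphic functions are holomorphic. -/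
theorem isClosed_diskAlgebra (R : ℝ) :
    IsClosed (diskAlgebra R : Set C(closedBall (0 : ℂ) R, ℂ)) := by
  refine isClosed_of_closure_subset fun g hg => ?_
  obtain ⟨u, hu, hlim⟩ := mem_closure_iff_seq_limit.1 hg
  have h1 := ContinuousMap.tendsto_iff_tendstoUniformly.1 hlim
  have h2 : TendstoUniformlyOn (fun n => extend R (u n)) (extend R g) atTop (ball 0 R) := by
    intro V hV
    filter_upwards [h1 V hV] with n hn z hz
    rw [extend_of_mem _ hz, extend_of_mem _ hz]
    exact hn _
  exact h2.tendstoLocallyUniformlyOn.differentiableOn (Eventually.of_forall hu) isOpen_ball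

instance instCompleteSpaceDiskAlgebra (R : ℝ) : CompleteSpace (diskAlgebra R) :=
  (isClosed_diskAlgebra R).completeSpace_coe

/-- Restriction of an entire function to a closed disk. -/
def restrictDisk (R : ℝ) (g : ℂ → ℂ) (hg : Differentiable ℂ g) : diskAlgebra R :=
  ⟨⟨fun z => g z, hg.continuous.comp continuous_subtype_val⟩,
    hg.differentiableOn.congr fun _ hz => by rw [extend_of_mem _ hz]; rfl⟩

/-- Evaluation at a point of the disk. -/
def evalDisk {R : ℝ} (z : closedBall (0 : ℂ) R) : diskAlgebra R →L[ℝ] ℂ :=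
  ((ContinuousMap.evalCLM ℂ z).restrictScalars ℝ).comp
    ((diskAlgebra R).toSubmodule.subtypeL.restrictScalars ℝ)

/-- The solution of a linear matrix equation with entire coefficients, on a disk. -/
theorem exists_hasDerivAt_disk (R : ℝ) {b : ℝ → ℂ → Matrix (Fin 2) (Fin 2) ℂ}
    (hb : ∀ t i j, Differentiable ℂ fun z => b t z i j)
    (hc : ∀ t, TendstoLocallyUniformly b (b t) (𝓝 t)) :
    ∃ Y : ℝ → ℂ → Matrix (Fin 2) (Fin 2) ℂ,
      (∀ z ∈ ball (0 : ℂ) R, Y 0 z = 1 ∧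
        ∀ t i j, HasDerivAt (fun s => Y s z i j) ((b t z * Y t z) i j) t) ∧
      ∀ t i j, DifferentiableOn ℂ (fun z => Y t z i j) (ball 0 R) := by
  -- Local uniformity in `z` makes the coefficients a continuous curve in the disk algebra. Point
  -- evaluations are continuous and linear, so the solution there gives the solution at each `z`.
  let β : ℝ → Fin 2 → Fin 2 → diskAlgebra R := fun t i j => restrictDisk R _ (hb t i j)
  have hβ : Continuous β := by
    refine continuous_pi fun i => continuous_pi fun j => Continuous.subtype_mk
      (f := fun t => (restrictDisk R _ (hb t i j)).1) ?_ _
    refine continuous_iff_continuousAt.2 fun t => ?_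
    refine ContinuousMap.tendsto_iff_tendstoUniformly.2 ?_
    have h1 := tendstoLocallyUniformly_iff_forall_isCompact.1 (hc t) _
      (isCompact_closedBall (0 : ℂ) R)
    have hpi : UniformContinuous fun M : Matrix (Fin 2) (Fin 2) ℂ => M i j :=
      (Pi.uniformContinuous_proj _ j).comp (Pi.uniformContinuous_proj _ i)
    have h2 := hpi.comp_tendstoUniformlyOn h1
    intro V hV
    filter_upwards [h2 V hV] with s hs z
    exact hs z z.2
  obtain ⟨Y, h0, hY⟩ := exists_hasDerivAt hβ fun i j => if i = j then 1 else 0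
  refine ⟨fun t z => Matrix.of fun i j => extend R (Y t i j).1 z, fun z hz => ⟨?_, fun t i j => ?_⟩,
    fun t i j => (Y t i j).2⟩
  · ext i j
    change Matrix.of (fun i j => extend R (Y 0 i j).1 z) i j = _
    rw [Matrix.of_apply, extend_of_mem _ hz, h0, Matrix.one_apply]
    by_cases hij : i = j <;> simp [hij]
  · have h1 := hasDerivAt_pi.1 (hasDerivAt_pi.1 (hY t) i) j
    have h2 := (evalDisk ⟨z, ball_subset_closedBall hz⟩).hasFDerivAt.comp_hasDerivAt t h1
    simp only [Matrix.of_apply, extend_of_mem _ hz, Matrix.mul_apply]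
    refine h2.congr_deriv ?_
    rw [arrayMul, map_sum]
    rfl

/-- Uniqueness for linear matrix equations, with entrywise derivatives. -/
theorem matrix_eq_of_hasDerivAt {b Y Z : ℝ → Matrix (Fin 2) (Fin 2) ℂ}
    (hb : ∀ i j, Continuous fun t => b t i j) (h0 : Y 0 = Z 0)
    (hY : ∀ t i j, HasDerivAt (fun s => Y s i j) ((b t * Y t) i j) t)
    (hZ : ∀ t i j, HasDerivAt (fun s => Z s i j) ((b t * Z t) i j) t) (t : ℝ) : Y t = Z t := by
  have hb' : Continuous fun t i j => b t i j :=
    continuous_pi fun i => continuous_pi fun j => hb i j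
  have h := eq_of_hasDerivAt (S := ℂ) (b := fun t i j => b t i j) (Y := fun t i j => Y t i j)
    (Z := fun t i j => Z t i j) hb' (by rw [h0])
    (fun t => hasDerivAt_pi.2 fun i => hasDerivAt_pi.2 fun j => by
      simpa only [arrayMul, Matrix.mul_apply] using hY t i j)
    (fun t => hasDerivAt_pi.2 fun i => hasDerivAt_pi.2 fun j => by
      simpa only [arrayMul, Matrix.mul_apply] using hZ t i j)
  exact Matrix.ext fun i j => congrFun (congrFun (congrFun h t) i) j

/-- The product rule for matrix valued functions, with entrywise derivatives. -/
theorem hasDerivAt_matrix_mul {X Y : ℝ → Matrix (Fin 2) (Fin 2) ℂ}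
    {X' Y' : Matrix (Fin 2) (Fin 2) ℂ} {t : ℝ}
    (hX : ∀ i j, HasDerivAt (fun s => X s i j) (X' i j) t)
    (hY : ∀ i j, HasDerivAt (fun s => Y s i j) (Y' i j) t) (i j : Fin 2) :
    HasDerivAt (fun s => (X s * Y s) i j) ((X' * Y t + X t * Y') i j) t := by
  simp only [Matrix.mul_apply, Matrix.add_apply, Fin.sum_univ_two]
  refine (((hX i 0).mul (hY 0 j)).add ((hX i 1).mul (hY 1 j))).congr_deriv ?_
  ring

theorem hasDerivAt_mul_const {X : ℝ → Matrix (Fin 2) (Fin 2) ℂ}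
    {X' : Matrix (Fin 2) (Fin 2) ℂ} {t : ℝ}
    (hX : ∀ i j, HasDerivAt (fun s => X s i j) (X' i j) t)
    (C : Matrix (Fin 2) (Fin 2) ℂ) (i j : Fin 2) :
    HasDerivAt (fun s => (X s * C) i j) ((X' * C) i j) t := by
  simpa using hasDerivAt_matrix_mul hX (Y := fun _ => C) (Y' := 0)
    (fun i j => hasDerivAt_const t (C i j)) i j

end LinearODE
end

noncomputable section

/-! ### The cocycles of the shift and of the flow -/

namespace Toda

open LinearODE Set

theorem IsRealEntire.mul {M N : MatFun} (hM : IsRealEntire M) (hN : IsRealEntire N) :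
    IsRealEntire fun z => M z * N z := by
  refine ⟨fun i j => ?_, fun x i j => ?_⟩
  · simp only [Matrix.mul_apply, Fin.sum_univ_two]
    exact ((hM.1 i 0).mul (hN.1 0 j)).add ((hM.1 i 1).mul (hN.1 1 j))
  · simp only [Matrix.mul_apply, Fin.sum_univ_two, Complex.add_im, Complex.mul_im, hM.2, hN.2]
    ring

theorem mul_mem_SLset {M N : MatFun} (hM : M ∈ SLset) (hN : N ∈ SLset) :
    (fun z => M z * N z) ∈ SLset :=
  ⟨hM.1.mul hN.1, fun z => by rw [Matrix.det_mul, hM.2, hN.2, mul_one]⟩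

theorem inv_eq_of_mem_SLset {M : MatFun} (hM : M ∈ SLset) (z : ℂ) :
    (M z)⁻¹ = !![M z 1 1, -M z 0 1; -M z 1 0, M z 0 0] := by
  rw [Matrix.inv_def, hM.2, Ring.inverse_one, one_smul, Matrix.adjugate_fin_two]

theorem inv_mem_SLset {M : MatFun} (hM : M ∈ SLset) : (fun z => (M z)⁻¹) ∈ SLset := by
  refine ⟨⟨fun i j => ?_, fun x i j => ?_⟩, fun z => ?_⟩
  · simp only [inv_eq_of_mem_SLset hM]
    fin_cases i <;> fin_cases j
    · exact hM.1.1 1 1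
    · exact (hM.1.1 0 1).neg
    · exact (hM.1.1 1 0).neg
    · exact hM.1.1 0 0
  · simp only [inv_eq_of_mem_SLset hM]
    fin_cases i <;> fin_cases j <;> simp [hM.1.2]
  · rw [Matrix.det_nonsing_inv, hM.2, Ring.inverse_one]

theorem isUnit_det_of_mem_SLset {M : MatFun} (hM : M ∈ SLset) (z : ℂ) : IsUnit (M z).det := by
  rw [hM.2]; exact isUnit_one

theorem one_mem_SLset : (fun _ => 1 : MatFun) ∈ SLset :=
  ⟨⟨fun _ _ => differentiable_const _, fun _ i j => by
    change ((1 : Matrix (Fin 2) (Fin 2) ℂ) i j).im = 0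
    rw [Matrix.one_apply]; split_ifs <;> simp⟩, fun _ => Matrix.det_one⟩

theorem transferA_mem_SLset (J : Jac) : transferA J ∈ SLset := by
  have ha : (coeffA J 1 : ℂ) ≠ 0 := Complex.ofReal_ne_zero.2 (coeffA_pos J 1).ne'
  refine ⟨⟨fun i j => ?_, fun x i j => ?_⟩, fun z => ?_⟩
  · fin_cases i <;> fin_cases j <;> simp [transferA, div_eq_mul_inv]
  · fin_cases i <;> fin_cases j
    · change (((x : ℂ) - (coeffB J 1 : ℂ)) / (coeffA J 1 : ℂ)).im = 0
      rw [← Complex.ofReal_sub, ← Complex.ofReal_div, Complex.ofReal_im]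
    · change ((1 : ℂ) / (coeffA J 1 : ℂ)).im = 0
      rw [← Complex.ofReal_one, ← Complex.ofReal_div, Complex.ofReal_im]
    · simp [transferA]
    · simp [transferA]
  · rw [transferA, Matrix.det_fin_two_of]
    field_simp
    ring

theorem transferNat_mem_SLset (n : ℕ) (J : Jac) : transferNat n J ∈ SLset := by
  induction n with
  | zero => exact one_mem_SLset
  | succ n ih => exact mul_mem_SLset (transferA_mem_SLset _) ih

theorem shiftCocycle_ofNat (n : ℕ) (J : Jac) : shiftCocycle n J = transferNat n J := by
  funext z
  rw [shiftCocycle, if_pos (Int.natCast_nonneg n), Int.toNat_natCast]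

theorem shiftCocycle_neg (n : ℕ) (J : Jac) (z : ℂ) :
    shiftCocycle (-n) J z = (transferNat n (shift (-n) J) z)⁻¹ := by
  rw [shiftCocycle]
  split_ifs with h
  · obtain rfl : n = 0 := by omega
    simp [transferNat]
  · rw [neg_neg, Int.toNat_natCast]

theorem shiftCocycle_mem_SLset (n : ℤ) (J : Jac) : shiftCocycle n J ∈ SLset := by
  obtain ⟨k, rfl | rfl⟩ := n.eq_nat_or_neg
  · rw [shiftCocycle_ofNat]
    exact transferNat_mem_SLset k J
  · have h : shiftCocycle (-k) J = fun z => (transferNat k (shift (-k) J) z)⁻¹ :=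
      funext fun z => shiftCocycle_neg k J z
    rw [h]
    exact inv_mem_SLset (transferNat_mem_SLset k _)

theorem shiftCocycle_zero (J : Jac) (z : ℂ) : shiftCocycle 0 J z = 1 := by
  rw [shiftCocycle, if_pos le_rfl]
  rfl

theorem transferNat_succ' (n : ℕ) (J : Jac) (z : ℂ) :
    transferNat (n + 1) J z = transferNat n (shift 1 J) z * transferA J z := by
  induction n with
  | zero =>
    change transferA (shift 0 J) z * 1 = 1 * transferA J z
    rw [shift_zero, mul_one, one_mul]
  | succ n ih =>
    change transferA (shift ((n + 1 : ℕ) : ℤ) J) z * transferNat (n + 1) J z =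
      transferA (shift n (shift 1 J)) z * transferNat n (shift 1 J) z * transferA J z
    rw [ih, mul_assoc, ← shift_add, Nat.cast_succ]

/-- One recursion valid for both signs of `n`, so that later inductions over `ℤ` avoid the case
distinction in the definition. -/
theorem shiftCocycle_add_one (n : ℤ) (J : Jac) (z : ℂ) :
    shiftCocycle (n + 1) J z = transferA (shift n J) z * shiftCocycle n J z := by
  rcases lt_or_ge n 0 with hn | hn
  · obtain ⟨k, rfl⟩ : ∃ k : ℕ, n = -((k + 1 : ℕ) : ℤ) := ⟨(-n - 1).toNat, by omega⟩
    have e : -((k + 1 : ℕ) : ℤ) + 1 = -(k : ℤ) := by push_cast; ring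
    rw [e, shiftCocycle_neg, shiftCocycle_neg, transferNat_succ', Matrix.mul_inv_rev, ← mul_assoc,
      ← shift_add, add_comm (1 : ℤ), e,
      Matrix.mul_nonsing_inv _ (isUnit_det_of_mem_SLset (transferA_mem_SLset _) z), one_mul]
  · lift n to ℕ using hn
    rw [← Nat.cast_succ, shiftCocycle_ofNat, shiftCocycle_ofNat]
    rfl

theorem shiftCocycle_one (J : Jac) (z : ℂ) : shiftCocycle 1 J z = transferA J z := by
  have h := shiftCocycle_add_one 0 J z
  rwa [zero_add, shift_zero, shiftCocycle_zero, mul_one] at h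

theorem transferA_mul_left_cancel {J : Jac} {z : ℂ} {M N : Matrix (Fin 2) (Fin 2) ℂ}
    (h : transferA J z * M = transferA J z * N) : M = N := by
  have hu := isUnit_det_of_mem_SLset (transferA_mem_SLset J) z
  have h1 := congrArg (fun X => (transferA J z)⁻¹ * X) h
  simpa only [← mul_assoc, Matrix.nonsing_inv_mul _ hu, one_mul] using h1

theorem shiftCocycle_add (m n : ℤ) (J : Jac) (z : ℂ) :
    shiftCocycle (m + n) J z = shiftCocycle m (shift n J) z * shiftCocycle n J z := by
  induction m using Int.induction_on with
  | zero => rw [zero_add, shiftCocycle_zero, one_mul]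
  | succ m ih =>
    rw [add_right_comm, shiftCocycle_add_one, ih, shiftCocycle_add_one, ← shift_add, mul_assoc]
  | pred m ih =>
    have h1 := shiftCocycle_add_one (-(m : ℤ) - 1 + n) J z
    have h2 := shiftCocycle_add_one (-(m : ℤ) - 1) (shift n J) z
    rw [show -(m : ℤ) - 1 + n + 1 = -(m : ℤ) + n by ring, ih] at h1
    rw [sub_add_cancel, ← shift_add] at h2
    rw [h2, mul_assoc] at h1
    exact (transferA_mul_left_cancel h1).symm

/-! ### The flow cocycle and the two implications. -/

section Flow

variable {f : ℝ → ℝ} {B : Jac → MatFun}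

/-- The standing assumptions on the function `f` and the generator `B`. -/
structure FlowData (f : ℝ → ℝ) (B : Jac → MatFun) : Prop where
  contDiff : ContDiff ℝ 2 f
  mem_slset : ∀ J, B J ∈ slset
  tendsto : ∀ J, TendstoLocallyUniformly B (B J) (𝓝 J)

theorem FlowData.continuous_entry (h : FlowData f B) (J : Jac) (z : ℂ) (i j : Fin 2) :
    Continuous fun t => B (flow f t J) z i j := by
  refine continuous_iff_continuousAt.2 fun t => ?_
  have h1 : Tendsto (fun K => B K z) (𝓝 (flow f t J)) (𝓝 (B (flow f t J) z)) :=
    (tendstoLocallyUniformlyOn_univ.2 (h.tendsto (flow f t J))).tendsto_at (mem_univ z)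
  have h2 : Tendsto (fun t => B (flow f t J) z) (𝓝 t) (𝓝 (B (flow f t J) z)) :=
    h1.comp (continuous_flow h.contDiff J).continuousAt
  exact tendsto_pi_nhds.1 (tendsto_pi_nhds.1 h2 i) j

theorem FlowData.exists_solution (h : FlowData f B) (J : Jac) (R : ℝ) :
    ∃ Y : ℝ → MatFun, (∀ z ∈ Metric.ball (0 : ℂ) R, IsFlowODESolution f B J z fun t => Y t z) ∧
      ∀ t i j, DifferentiableOn ℂ (fun z => Y t z i j) (Metric.ball 0 R) := by
  refine exists_hasDerivAt_disk R (b := fun t => B (flow f t J))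
    (fun t i j => (h.mem_slset _).1.1 i j) fun t V hV z => ?_
  obtain ⟨s, hs, he⟩ := h.tendsto (flow f t J) V hV z
  exact ⟨s, hs, (continuous_flow h.contDiff J).continuousAt.eventually he⟩

theorem FlowData.isFlowODESolution (h : FlowData f B) (J : Jac) (z : ℂ) :
    IsFlowODESolution f B J z fun t => flowCocycle f B t J z := by
  obtain ⟨Y, hY, -⟩ := h.exists_solution J (‖z‖ + 1)
  have hex : ∃ Y, IsFlowODESolution f B J z Y := ⟨_, hY z (by simp)⟩
  have e : (fun t => flowCocycle f B t J z) = hex.choose := funext fun t => dif_pos hex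
  rw [e]
  exact hex.choose_spec

theorem FlowData.eq_flowCocycle (h : FlowData f B) {J : Jac} {z : ℂ}
    {Y : ℝ → Matrix (Fin 2) (Fin 2) ℂ} (hY : IsFlowODESolution f B J z Y) (t : ℝ) :
    Y t = flowCocycle f B t J z :=
  matrix_eq_of_hasDerivAt (h.continuous_entry J z)
    (hY.1.trans (h.isFlowODESolution J z).1.symm) hY.2 (h.isFlowODESolution J z).2 t

theorem FlowData.flowCocycle_zero (h : FlowData f B) (J : Jac) (z : ℂ) :
    flowCocycle f B 0 J z = 1 := (h.isFlowODESolution J z).1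

/-- The cocycle is chosen separately for each `z`; by uniqueness it agrees on every disk with the
holomorphic solution. -/
theorem FlowData.differentiable_flowCocycle (h : FlowData f B) (t : ℝ) (J : Jac) (i j : Fin 2) :
    Differentiable ℂ fun z => flowCocycle f B t J z i j := by
  intro z
  obtain ⟨Y, hY, hd⟩ := h.exists_solution J (‖z‖ + 1)
  have h1 : DifferentiableOn ℂ (fun z => flowCocycle f B t J z i j)
      (Metric.ball 0 (‖z‖ + 1)) := (hd t i j).congr fun w hw => by
    rw [← h.eq_flowCocycle (hY w hw)]
  exact h1.differentiableAt (Metric.isOpen_ball.mem_nhds (by simp))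

/-- At real `x` the entries of `B` are real, so the conjugate solves the same equation. -/
theorem FlowData.im_flowCocycle (h : FlowData f B) (t : ℝ) (J : Jac) (x : ℝ) (i j : Fin 2) :
    (flowCocycle f B t J x i j).im = 0 := by
  have hs := h.isFlowODESolution J x
  have hc : IsFlowODESolution f B J x fun t => (flowCocycle f B t J x).map star := by
    refine ⟨?_, fun t i j => ?_⟩
    · simp [hs.1]
    · have h1 := Complex.conjCLE.toContinuousLinearMap.hasFDerivAt.comp_hasDerivAt t (hs.2 t i j)
      refine h1.congr_deriv ?_
      have hB : ∀ k, star (B (flow f t J) x i k) = B (flow f t J) x i k := fun k =>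
        Complex.conj_eq_iff_im.2 ((h.mem_slset _).1.2 x i k)
      change star _ = _
      simp only [Matrix.mul_apply, star_sum, star_mul', hB, Matrix.map_apply]
  have h2 := congrFun (congrFun (h.eq_flowCocycle hc t) i) j
  exact Complex.conj_eq_iff_im.1 h2

/-- Liouville's formula: the derivative of the determinant is `tr B` times the determinant, which is
zero. -/
theorem FlowData.det_flowCocycle (h : FlowData f B) (t : ℝ) (J : Jac) (z : ℂ) :
    (flowCocycle f B t J z).det = 1 := by
  have hs := h.isFlowODESolution J z
  have hd : ∀ t, HasDerivAt (fun t => (flowCocycle f B t J z).det) 0 t := by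
    intro t
    have htr := (h.mem_slset (flow f t J)).2 z
    rw [Matrix.trace_fin_two] at htr
    simp only [Matrix.det_fin_two]
    refine (((hs.2 t 0 0).mul (hs.2 t 1 1)).sub ((hs.2 t 0 1).mul (hs.2 t 1 0))).congr_deriv ?_
    simp only [Matrix.mul_apply, Fin.sum_univ_two]
    linear_combination (flowCocycle f B t J z 0 0 * flowCocycle f B t J z 1 1 -
      flowCocycle f B t J z 0 1 * flowCocycle f B t J z 1 0) * htr
  have h1 := is_const_of_deriv_eq_zero (fun t => (hd t).differentiableAt) (fun t => (hd t).deriv) t 0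
  rw [h1, h.flowCocycle_zero, Matrix.det_one]

theorem FlowData.flowCocycle_mem_SLset (h : FlowData f B) (t : ℝ) (J : Jac) :
    flowCocycle f B t J ∈ SLset :=
  ⟨⟨h.differentiable_flowCocycle t J, h.im_flowCocycle t J⟩, h.det_flowCocycle t J⟩

theorem FlowData.flowCocycle_add (h : FlowData f B) (s t : ℝ) (J : Jac) (z : ℂ) :
    flowCocycle f B (s + t) J z = flowCocycle f B s (flow f t J) z * flowCocycle f B t J z := by
  refine matrix_eq_of_hasDerivAt (Y := fun s => flowCocycle f B (s + t) J z)
    (Z := fun s => flowCocycle f B s (flow f t J) z * flowCocycle f B t J z)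
    (h.continuous_entry (flow f t J) z) ?_ (fun s i j => ?_) (fun s i j => ?_) s
  · simp only [zero_add, h.flowCocycle_zero, one_mul]
  · have := ((h.isFlowODESolution J z).2 (s + t) i j).comp_add_const s t
    rwa [flow_add h.contDiff] at this
  · rw [← mul_assoc]
    exact hasDerivAt_mul_const ((h.isFlowODESolution (flow f t J) z).2 s) _ i j

/-- Zero curvature speaks of time `0` only; the group property of the flow moves it along the orbit,
and commutation with the shift puts `B` at the point `t·(1·J)`. -/
theorem FlowData.hasDerivAt_transferA (h : FlowData f B) (hz : ZeroCurvature f B) (J : Jac) (z : ℂ)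
    (t : ℝ) (i j : Fin 2) : HasDerivAt (fun s => transferA (flow f s J) z i j)
      ((B (flow f t (shift 1 J)) z * transferA (flow f t J) z -
        transferA (flow f t J) z * B (flow f t J) z) i j) t := by
  have h1 := hz (flow f t J) z i j
  rw [← flow_shift h.contDiff, ← sub_self t] at h1
  have h2 := h1.comp_sub_const t t
  refine h2.congr_of_eventuallyEq (Eventually.of_forall fun s => ?_)
  beta_reduce
  rw [← flow_add h.contDiff, sub_add_cancel]

/-- Under the zero curvature equation, the flow cocycle intertwines the transfer matrices. -/
theorem FlowData.flowCocycle_mul_transferA (h : FlowData f B) (hz : ZeroCurvature f B) (t : ℝ)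
    (J : Jac) (z : ℂ) : flowCocycle f B t (shift 1 J) z * transferA J z =
      transferA (flow f t J) z * flowCocycle f B t J z := by
  refine matrix_eq_of_hasDerivAt (Y := fun t => flowCocycle f B t (shift 1 J) z * transferA J z)
    (Z := fun t => transferA (flow f t J) z * flowCocycle f B t J z)
    (h.continuous_entry (shift 1 J) z) ?_ (fun s i j => ?_) (fun s i j => ?_) t
  · simp only [h.flowCocycle_zero, one_mul, mul_one, flow_zero h.contDiff]
  · rw [← mul_assoc]
    exact hasDerivAt_mul_const ((h.isFlowODESolution (shift 1 J) z).2 s) _ i j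
  -- The term `-A B T` from the derivative of `A` cancels `A T' = A B T`.
  · refine (hasDerivAt_matrix_mul (h.hasDerivAt_transferA hz J z s)
      ((h.isFlowODESolution J z).2 s) i j).congr_deriv ?_
    beta_reduce
    rw [sub_mul, mul_assoc, mul_assoc, sub_add_cancel]

theorem FlowData.flowCocycle_mul_shiftCocycle (h : FlowData f B) (hz : ZeroCurvature f B) (t : ℝ)
    (m : ℤ) (J : Jac) (z : ℂ) : flowCocycle f B t (shift m J) z * shiftCocycle m J z =
      shiftCocycle m (flow f t J) z * flowCocycle f B t J z := by
  have hstep : ∀ m : ℤ, flowCocycle f B t (shift (m + 1) J) z * transferA (shift m J) z =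
      transferA (shift m (flow f t J)) z * flowCocycle f B t (shift m J) z := fun m => by
    have := h.flowCocycle_mul_transferA hz t (shift m J) z
    rwa [← shift_add, add_comm 1 m, flow_shift h.contDiff] at this
  induction m using Int.induction_on with
  | zero => rw [shift_zero, shiftCocycle_zero, shiftCocycle_zero, one_mul, mul_one]
  | succ m ih =>
    rw [shiftCocycle_add_one, ← mul_assoc, hstep, mul_assoc, ih, shiftCocycle_add_one, mul_assoc]
  | pred m ih =>
    have h1 := hstep (-(m : ℤ) - 1)
    have h2 := shiftCocycle_add_one (-(m : ℤ) - 1) J z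
    have h3 := shiftCocycle_add_one (-(m : ℤ) - 1) (flow f t J) z
    rw [sub_add_cancel] at h1 h2 h3
    rw [h2, h3, ← mul_assoc, h1, mul_assoc, mul_assoc] at ih
    exact transferA_mul_left_cancel ih

/-- After expanding both cocycles, the two sides differ only in the order of the middle factors,
which the exchange relation corrects. -/
theorem FlowData.isSLCocycle_glued (h : FlowData f B) (hz : ZeroCurvature f B) :
    IsSLCocycle (jointAct f) (glued f B) := by
  refine ⟨fun g J => mul_mem_SLset (h.flowCocycle_mem_SLset _ _) (shiftCocycle_mem_SLset _ _), ?_⟩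
  rintro ⟨s, m⟩ ⟨t, n⟩ J z
  change flowCocycle f B (s + t) (shift (m + n) J) z * shiftCocycle (m + n) J z =
    flowCocycle f B s (shift m (flow f t (shift n J))) z *
      shiftCocycle m (flow f t (shift n J)) z *
      (flowCocycle f B t (shift n J) z * shiftCocycle n J z)
  rw [shift_add, shiftCocycle_add, h.flowCocycle_add, ← flow_shift h.contDiff]
  have h1 := h.flowCocycle_mul_shiftCocycle hz t m (shift n J) z
  simp only [mul_assoc]
  rw [← mul_assoc (flowCocycle f B t (shift m (shift n J)) z), h1, mul_assoc]

/-- The cocycle identity for `(0, 1) + (t, 0)` compares the flow followed by the shift with the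
defining formula for the glued function. -/
theorem FlowData.transferA_flow_eq (h : FlowData f B)
    (hc : IsSLCocycle (jointAct f) (glued f B)) (t : ℝ) (J : Jac) (z : ℂ) :
    transferA (flow f t J) z =
      flowCocycle f B t (shift 1 J) z * transferA J z * (flowCocycle f B t J z)⁻¹ := by
  have h1 := hc.2 (0, 1) (t, 0) J z
  simp only [glued, jointAct, Prod.mk_add_mk, zero_add, add_zero, shift_zero, shiftCocycle_zero,
    shiftCocycle_one, h.flowCocycle_zero, one_mul, mul_one] at h1
  rw [h1, mul_assoc, Matrix.mul_nonsing_inv _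
    (isUnit_det_of_mem_SLset (h.flowCocycle_mem_SLset t J) z), mul_one]

theorem FlowData.hasDerivAt_inv_flowCocycle (h : FlowData f B) (J : Jac) (z : ℂ) (i j : Fin 2) :
    HasDerivAt (fun t => (flowCocycle f B t J z)⁻¹ i j) ((-B J z) i j) 0 := by
  have hs : ∀ i j, HasDerivAt (fun t => flowCocycle f B t J z i j) (B J z i j) 0 := fun i j => by
    have := (h.isFlowODESolution J z).2 0 i j
    beta_reduce at this
    rwa [h.flowCocycle_zero, mul_one, flow_zero h.contDiff] at this
  have htr := (h.mem_slset J).2 z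
  rw [Matrix.trace_fin_two] at htr
  -- For determinant one the inverse is the adjugate, linear in the entries; since `B` is traceless,
  -- its adjugate is `-B`.
  simp only [inv_eq_of_mem_SLset (h.flowCocycle_mem_SLset _ J)]
  fin_cases i <;> fin_cases j
  · exact (hs 1 1).congr_deriv (eq_neg_of_add_eq_zero_right htr)
  · exact (hs 0 1).neg
  · exact (hs 1 0).neg
  · exact (hs 0 0).congr_deriv (eq_neg_of_add_eq_zero_left htr)

theorem FlowData.zeroCurvature (h : FlowData f B)
    (hc : IsSLCocycle (jointAct f) (glued f B)) : ZeroCurvature f B := by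
  intro J z i j
  simp only [h.transferA_flow_eq hc _ J z]
  have h1 := hasDerivAt_matrix_mul
    (hasDerivAt_mul_const ((h.isFlowODESolution (shift 1 J) z).2 0) (transferA J z))
    (h.hasDerivAt_inv_flowCocycle J z) i j
  refine h1.congr_deriv ?_
  beta_reduce
  rw [h.flowCocycle_zero, h.flowCocycle_zero, inv_one, flow_zero h.contDiff]
  simp only [mul_one, one_mul, mul_neg, sub_eq_add_neg]

end Flow

end Toda
end

theorem theorem3p1 (f : ℝ → ℝ) (hf : ContDiff ℝ 2 f)
    (B : Toda.Jac → Toda.MatFun) (hBsl : ∀ J, B J ∈ Toda.slset)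
    (hBcont : ∀ J, TendstoLocallyUniformly B (B J) (𝓝 J)) :
    Toda.IsSLCocycle (Toda.jointAct f) (Toda.glued f B) ↔ Toda.ZeroCurvature f B :=
  have h : Toda.FlowData f B := ⟨hf, hBsl, hBcont⟩
  ⟨h.zeroCurvature, h.isSLCocycle_glued⟩
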